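/- For $m\ge 0$ let $H_m$ be the $m$-th Hermite polynomial ($H_0=1$, $H_{m+1}=2xH_m-H_m'$) and, for $n\ge 1$, let $h_n(x)=\gamma_{n-1}H_{n-1}(x)e^{-x^2/2}$, where $\gamma_{n-1}>0$ is chosen so that $\|h_n\|_{L^2(\mathbb{R})}=1$; these are the normalized eigenfunctions of the harmonic oscillator $-\frac{d^2}{dx^2}+x^2$ on the line. For $n\ge 1$ put $\vec h(c)=(h_1(c),\dots,h_n(c))$, $$\mathfrak{S}_n(x_1,\dots,x_n)=\det\big(h_i(x_j)\big)_{1\le i,j\le n},\qquad P_n(x_1,\dots,x_n)=\prod_{1\le i<j\le n}(x_i-x_j),\qquad \Omega_n=\{x\in\mathbb{R}^n : x_1<x_2<\dots<x_n\}.$$ The Dirichlet realization of $-\Delta+|x|^2$ in $\Omega_n$ is the self-adjoint operator associated with the quadratic form $\int_{\Omega_n}(|\nabla u|^2+|x|^2u^2)\,dx$, whose domain is the closure of $C_c^\infty(\Omega_n)$ for the norm $\big(\int_{\Omega_n}(u^2+|\nabla u|^2+|x|^2u^2)\,dx\big)^{1/2}$. Let $n\ge1$. Then the following holds. 0. There is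 a nonzero constant $B_n$ such that $\mathfrak{S}_n(x)=B_n\,e^{-|x|^2/2}P_n(x)$ for all $x\in\mathbb{R}^n$. 1. The function $\mathfrak{S}_n$ is the first Dirichlet eigenfunction of $-\Delta+|x|^2$ in $\Omega_n$: its restriction to $\Omega_n$ is an eigenfunction of the Dirichlet realization for the smallest eigenvalue, this eigenvalue is a lower bound of the quadratic form relative to $\|u\|_{L^2}^2$ (that is, it is the bottom of the spectrum), and it is simple. 2. For any distinct $c_1,\dots,c_{n-1}\in\mathbb{R}$, the vectors $\vec h(c_1),\dots,\vec h(c_{n-1})$ are linearly independent. 3. Let $b\in\mathbb{R}^n\setminus\{0\}$. The linear combination $S_b=\sum_{j=1}^n b_jh_j$ has at most $n-1$ distinct real zeros. If its set of real zeros consists of exactly $n-1$ distinct points $c_1,\dots,c_{n-1}$, then there is a nonzero constant $C$ such that $S_b(x)=C\,\mathfrak{S}_n(c_1,\dots,c_{n-1},x)$ for all $x\in\mathbb{R}$. 4. For any distinct $c_1,\dots,c_{n-1}\in\mathbb{R}$, the function $x\mapsto\mathfrak{S}_n(c_1,\dots,c_{n-1},x)$ vanishes at order exactly $1$ at each $c_j$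 and has no other real zero. -/

import Mathlib

open MeasureTheory Filter Topology Set
open scoped ContDiff

namespace SlaterHO

noncomputable section

/-! ### Hermite functions and Slater determinants -/

/-- The physicists' Hermite polynomials: `H₀ = 1`, `H_{m+1} = 2 X H_m - H_m'`
(degree `m`, leading coefficient `2 ^ m`). -/
def hermiteH : ℕ → Polynomial ℝ
  | 0 => 1
  | m + 1 => 2 * Polynomial.X * hermiteH m - Polynomial.derivative (hermiteH m)

/-- The normalizing constant `γ_m > 0`, which makes `γ_m H_m(x) exp(-x²/2)` a unit vector of
`L²(ℝ)`. -/
def normConst (m : ℕ) : ℝ :=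
  (Real.sqrt (∫ x : ℝ, ((hermiteH m).eval x * Real.exp (-x ^ 2 / 2)) ^ 2))⁻¹

/-- The normalized eigenfunctions of `-d²/dx² + x²` on the line, indexed from `0`:
`hermiteFun m = h_{m+1}` belongs to the eigenvalue `2 m + 1`. -/
def hermiteFun (m : ℕ) (x : ℝ) : ℝ :=
  normConst m * (hermiteH m).eval x * Real.exp (-x ^ 2 / 2)

/-- The vector `(h_1(x), …, h_n(x))`. -/
def hVec (n : ℕ) (x : ℝ) : Fin n → ℝ := fun i => hermiteFun i x

/-- The linear combination `∑ b_j h_j` of `h_1, …, h_n`. -/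
def linComb {n : ℕ} (b : Fin n → ℝ) (x : ℝ) : ℝ := ∑ j, b j * hermiteFun j x

/-- The Slater determinant: the determinant whose `j`-th column is `(h_1(x_j), …, h_n(x_j))`. -/
def slater (n : ℕ) (x : Fin n → ℝ) : ℝ :=
  Matrix.det (Matrix.of fun i j : Fin n => hermiteFun i (x j))

/-- The polynomial `P_n(x_1, …, x_n) = ∏_{i < j} (x_i - x_j)`. -/
def vdm (n : ℕ) (x : Fin n → ℝ) : ℝ := ∏ i, ∏ j ∈ Finset.Ioi i, (x i - x j)

/-! ### The Dirichlet realization of `-Δ + |x|²` in `{x_1 < ⋯ < x_n}` -/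

/-- The domain `{x_1 < x_2 < ⋯ < x_n}` of `ℝⁿ`. -/
def chamber (n : ℕ) : Set (EuclideanSpace ℝ (Fin n)) := {x | ∀ i j : Fin n, i < j → x i < x j}

/-- Lebesgue measure on the domain. -/
def chamberMeasure (n : ℕ) : Measure (EuclideanSpace ℝ (Fin n)) := volume.restrict (chamber n)

/-- `φ` is a smooth function with compact support contained in the domain. -/
structure IsTest (n : ℕ) (φ : EuclideanSpace ℝ (Fin n) → ℝ) : Prop where
  smooth : ContDiff ℝ ∞ φ
  compact : HasCompactSupport φ
  support : tsupport φ ⊆ chamber n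

/-- `u` lies in the form domain of the Dirichlet realization (Friedrichs extension) of
`-Δ + |x|²` on the domain, and `G` is its weak gradient. The form domain is the closure of the
test functions for the norm `(∫ u² + |∇u|² + |x|² u²)^{1/2}`. -/
structure InFormDomain (n : ℕ) (u : EuclideanSpace ℝ (Fin n) → ℝ)
    (G : EuclideanSpace ℝ (Fin n) → EuclideanSpace ℝ (Fin n)) : Prop where
  memLp : MemLp u 2 (chamberMeasure n)
  memLp_grad : MemLp G 2 (chamberMeasure n)
  memLp_weight : MemLp (fun x => ‖x‖ * u x) 2 (chamberMeasure n)
  approx : ∃ φ : ℕ → EuclideanSpace ℝ (Fin n) → ℝ, (∀ k, IsTest n (φ k)) ∧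
    Tendsto (fun k => eLpNorm (fun x => φ k x - u x) 2 (chamberMeasure n)) atTop (𝓝 0) ∧
    Tendsto (fun k => eLpNorm (fun x => gradient (φ k) x - G x) 2 (chamberMeasure n))
      atTop (𝓝 0) ∧
    Tendsto (fun k => eLpNorm (fun x => ‖x‖ * (φ k x - u x)) 2 (chamberMeasure n)) atTop (𝓝 0)

/-- `u` is an eigenfunction, for the eigenvalue `lam`, of the Dirichlet realization of
`-Δ + |x|²` on the domain: `u` is a nonzero element of the form domain, and
`∫ ∇u · ∇φ + |x|² u φ = lam ∫ u φ` for every test function `φ`. -/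
def IsDirichletEigenfunction (n : ℕ) (lam : ℝ) (u : EuclideanSpace ℝ (Fin n) → ℝ) : Prop :=
  (¬ u =ᵐ[chamberMeasure n] 0) ∧
  ∃ G : EuclideanSpace ℝ (Fin n) → EuclideanSpace ℝ (Fin n), InFormDomain n u G ∧
    ∀ φ : EuclideanSpace ℝ (Fin n) → ℝ, IsTest n φ →
      ∫ x, (inner ℝ (G x) (gradient φ x) + ‖x‖ ^ 2 * u x * φ x) ∂(chamberMeasure n)
        = lam * ∫ x, u x * φ x ∂(chamberMeasure n)

/-- `u` is the first Dirichlet eigenfunction of `-Δ + |x|²` on the domain (which is unique up to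
a factor): it is an eigenfunction for an eigenvalue `lam` which is the least eigenvalue and a
lower bound of the quadratic form of the operator, and this eigenvalue is simple. -/
def IsFirstDirichletEigenfunction (n : ℕ) (u : EuclideanSpace ℝ (Fin n) → ℝ) : Prop :=
  ∃ lam : ℝ, IsDirichletEigenfunction n lam u ∧
    (∀ (μ : ℝ) (v : EuclideanSpace ℝ (Fin n) → ℝ), IsDirichletEigenfunction n μ v → lam ≤ μ) ∧
    (∀ φ : EuclideanSpace ℝ (Fin n) → ℝ, IsTest n φ →
      lam * ∫ x, φ x ^ 2 ∂(chamberMeasure n)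
        ≤ ∫ x, (‖gradient φ x‖ ^ 2 + ‖x‖ ^ 2 * φ x ^ 2) ∂(chamberMeasure n)) ∧
    (∀ v : EuclideanSpace ℝ (Fin n) → ℝ, IsDirichletEigenfunction n lam v →
      ∃ C : ℝ, v =ᵐ[chamberMeasure n] fun x => C * u x)

end

end SlaterHO

namespace SlaterHO

/-! ### Gaussian decay -/

/-! Algebra. `hermiteH m` has degree `m` and leading coefficient `2 ^ m`, so up to a nonzero factor
the Slater matrix has a Vandermonde determinant times one Gaussian per column. With `c` fixed, the
determinant is therefore a nonzero constant times a Gaussian times `∏ (x - c j)`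
(`exists_slater_snoc_eq`), which settles its zeros. A combination of `h_1, …, h_n` is a Gaussian
times a nonzero polynomial of degree at most `n - 1`; the zero count and the identification with the
determinant follow by divisibility.

Spectrum. Write `U` for the Slater determinant. It is a signed sum over permutations of products of
one-dimensional eigenfunctions, all with the same total energy `λ = 1 + 3 + ⋯ + (2 n - 1)`, so `-ΔU
+ |x|² U = λ U` on the whole space. `U` has no zero in the chamber and vanishes on its boundary. The
smooth truncations `ε * cutId (U / ε)` place it in the form domain (`inFormDomain_slaterE`).
Substituting `φ = U w` for a test function gives `∫ |∇φ|² + |x|² φ² = λ ∫ φ² + ∫ U² |∇w|²`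
(`ground_state_representation`), hence the lower bound. Along test functions approximating an
eigenfunction `v` with eigenvalue `μ`, the last term tends to `(μ - λ) ∫ v²`, so `λ ≤ μ`. If `μ =
λ`, the weighted gradients tend to zero, and a Poincaré inequality on compact convex pieces of the
chamber forces `v / U` to be constant (`ae_eq_of_tendsto_of_tendsto_fderiv`). -/

lemma one_add_pow_mul_exp_le (N : ℕ) {r : ℝ} (hr : 0 ≤ r) :
    (1 + r) ^ N * Real.exp (-r ^ 2 / 2) ≤ Real.exp ((N : ℝ) ^ 2 / 2) := by
  have h1 : (1 + r) ^ N ≤ Real.exp (N * r) := by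
    rw [Real.exp_nat_mul]
    exact pow_le_pow_left₀ (by linarith) (by linarith [Real.add_one_le_exp r]) N
  calc (1 + r) ^ N * Real.exp (-r ^ 2 / 2) ≤ Real.exp (N * r) * Real.exp (-r ^ 2 / 2) := by gcongr
    _ = Real.exp (N * r + -r ^ 2 / 2) := (Real.exp_add _ _).symm
    _ ≤ _ := Real.exp_le_exp.2 (by nlinarith [sq_nonneg ((N : ℝ) - r)])

/-- Trades the Gaussian for decay of any chosen order `N`: a large `N` gives integrability, and `N =
1` bounds the superlevel sets of the Slater determinant. -/
lemma gaussian_bound_decay {C : ℝ} (hC : 0 ≤ C) (k N : ℕ) {r : ℝ} (hr : 0 ≤ r) :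
    C * (1 + r) ^ k * Real.exp (-r ^ 2 / 2)
      ≤ C * Real.exp (((k + N : ℕ) : ℝ) ^ 2 / 2) * ((1 + r) ^ N)⁻¹ := by
  have h := one_add_pow_mul_exp_le (k + N) hr
  have hp : 0 < (1 + r) ^ N := by positivity
  rw [← div_eq_mul_inv, le_div_iff₀ hp]
  calc C * (1 + r) ^ k * Real.exp (-r ^ 2 / 2) * (1 + r) ^ N
      = C * ((1 + r) ^ (k + N) * Real.exp (-r ^ 2 / 2)) := by ring
    _ ≤ _ := by gcongr

lemma memLp_two_of_gaussian_bound {E F : Type*} [NormedAddCommGroup E] [NormedSpace ℝ E]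
    [FiniteDimensional ℝ E] [MeasurableSpace E] [BorelSpace E] (μ : Measure E)
    [μ.IsAddHaarMeasure] [NormedAddCommGroup F] {f : E → F} (hf : AEStronglyMeasurable f μ)
    {C : ℝ} {k : ℕ} (hb : ∀ x, ‖f x‖ ≤ C * (1 + ‖x‖) ^ k * Real.exp (-‖x‖ ^ 2 / 2)) :
    MemLp f 2 μ := by
  have hC : 0 ≤ C := by
    have := (norm_nonneg _).trans (hb 0)
    simpa using this
  rw [memLp_two_iff_integrable_sq_norm hf]
  -- Any exponent above the dimension makes `(1 + ‖x‖) ^ (-N)` integrable; one of the two factors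
  -- produced by squaring is then simply bounded by `1`.
  set N := Module.finrank ℝ E + 1
  set D := C * Real.exp (((k + N : ℕ) : ℝ) ^ 2 / 2)
  have hint : Integrable (fun x : E => D ^ 2 * (1 + ‖x‖) ^ (-(N : ℝ))) μ :=
    (integrable_one_add_norm (by simp [N])).const_mul _
  refine hint.mono' (hf.norm.pow 2) (Eventually.of_forall fun x => ?_)
  have h1 := (hb x).trans (gaussian_bound_decay hC k N (norm_nonneg x))
  rw [Real.norm_of_nonneg (by positivity), Real.rpow_neg (by positivity), Real.rpow_natCast]
  have hge : 1 ≤ (1 + ‖x‖) ^ N := one_le_pow₀ (by linarith [norm_nonneg x])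
  have hi : ((1 + ‖x‖) ^ N)⁻¹ ≤ 1 := inv_le_one_of_one_le₀ hge
  have hi0 : 0 ≤ ((1 + ‖x‖) ^ N)⁻¹ := by positivity
  calc ‖f x‖ ^ 2 ≤ (D * ((1 + ‖x‖) ^ N)⁻¹) ^ 2 := pow_le_pow_left₀ (norm_nonneg _) h1 2
    _ = D ^ 2 * (((1 + ‖x‖) ^ N)⁻¹ * ((1 + ‖x‖) ^ N)⁻¹) := by ring
    _ ≤ D ^ 2 * (((1 + ‖x‖) ^ N)⁻¹ * 1) := by gcongr
    _ = _ := by ring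

/-! ### Hermite polynomials -/

open Polynomial in
lemma hermiteH_natDegree_le_and_coeff (m : ℕ) :
    (hermiteH m).natDegree ≤ m ∧ (hermiteH m).coeff m = 2 ^ m := by
  induction m with
  | zero => simp [hermiteH]
  | succ m ih =>
    obtain ⟨h1, h2⟩ := ih
    have hd : (derivative (hermiteH m)).natDegree ≤ m :=
      (natDegree_derivative_le _).trans (by omega)
    have e : (2 * X * hermiteH m : ℝ[X]) = C 2 * (hermiteH m * X) := by
      rw [show (C 2 : ℝ[X]) = 2 from rfl]; ring
    constructor
    · rw [hermiteH]
      refine (natDegree_sub_le _ _).trans (max_le ?_ (by omega))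
      rw [e]
      refine (natDegree_C_mul_le _ _).trans (natDegree_mul_le.trans ?_)
      simpa using h1
    · rw [hermiteH, coeff_sub, coeff_eq_zero_of_natDegree_lt (p := derivative _) (by omega), e,
        coeff_C_mul, coeff_mul_X, h2]
      ring

lemma hermiteH_natDegree (m : ℕ) : (hermiteH m).natDegree = m := by
  obtain ⟨h1, h2⟩ := hermiteH_natDegree_le_and_coeff m
  exact le_antisymm h1 (Polynomial.le_natDegree_of_ne_zero (by rw [h2]; positivity))

lemma hermiteH_leadingCoeff (m : ℕ) : (hermiteH m).leadingCoeff = 2 ^ m := by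
  rw [Polynomial.leadingCoeff, hermiteH_natDegree, (hermiteH_natDegree_le_and_coeff m).2]

lemma hermiteH_ne_zero (m : ℕ) : hermiteH m ≠ 0 := by
  rw [← Polynomial.leadingCoeff_ne_zero, hermiteH_leadingCoeff]; positivity

lemma exists_abs_eval_le (p : Polynomial ℝ) :
    ∃ (C : ℝ) (k : ℕ), ∀ x : ℝ, ‖p.eval x‖ ≤ C * (1 + ‖x‖) ^ k := by
  refine ⟨∑ i ∈ p.support, |p.coeff i|, p.natDegree, fun x => ?_⟩
  rw [Polynomial.eval_eq_sum, Polynomial.sum, Finset.sum_mul]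
  refine (norm_sum_le _ _).trans (Finset.sum_le_sum fun i hi => ?_)
  rw [norm_mul, norm_pow]
  refine mul_le_mul_of_nonneg_left ?_ (abs_nonneg _)
  calc ‖x‖ ^ i ≤ (1 + ‖x‖) ^ i := by gcongr; linarith
    _ ≤ _ := pow_le_pow_right₀ (by linarith [norm_nonneg x]) (Polynomial.le_natDegree_of_mem_supp _ hi)

lemma normConst_pos (m : ℕ) : 0 < normConst m := by
  rw [normConst, inv_pos, Real.sqrt_pos]
  set f : ℝ → ℝ := fun x => (hermiteH m).eval x * Real.exp (-x ^ 2 / 2)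
  have hfc : Continuous f := by fun_prop
  obtain ⟨C, k, hC⟩ := exists_abs_eval_le (hermiteH m)
  -- Integrability is essential here: a divergent integral has value `0` by convention, and the
  -- constant would then be `0⁻¹ = 0`.
  have hL : MemLp f 2 (volume : Measure ℝ) := by
    refine memLp_two_of_gaussian_bound _ hfc.aestronglyMeasurable (C := C) (k := k) fun x => ?_
    rw [norm_mul, Real.norm_of_nonneg (Real.exp_pos _).le, Real.norm_eq_abs x, sq_abs]
    gcongr
    exact hC x
  have hint : Integrable (fun x => f x ^ 2) := hL.integrable_sq
  change 0 < ∫ x, f x ^ 2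
  rw [integral_pos_iff_support_of_nonneg (fun x => sq_nonneg _) hint]
  have ho : IsOpen (Function.support fun x => f x ^ 2) := (hfc.pow 2).isOpen_support
  refine ho.measure_pos _ ?_
  by_contra hne
  rw [Set.not_nonempty_iff_eq_empty, Function.support_eq_empty_iff] at hne
  refine hermiteH_ne_zero m (Polynomial.funext fun x => ?_)
  have := congrFun hne x
  simpa [f] using this

/-! ### The product formula -/

lemma prod_gaussian {ι : Type*} [Fintype ι] (x : ι → ℝ) :
    ∏ i, Real.exp (-x i ^ 2 / 2) = Real.exp (-(∑ i, x i ^ 2) / 2) := by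
  rw [← Real.exp_sum, ← Finset.sum_div, Finset.sum_neg_distrib]

lemma det_hermiteH (n : ℕ) (x : Fin n → ℝ) :
    Matrix.det (Matrix.of fun i j : Fin n => (hermiteH i).eval (x j))
      = (∏ i : Fin n, (2 : ℝ) ^ (i : ℕ)) * Matrix.det (Matrix.vandermonde x) := by
  -- Dividing row `i` by its leading coefficient `2 ^ i` gives monic polynomials of degree `i`,
  -- whose determinant is exactly the Vandermonde one.
  have h := Matrix.det_eval_matrixOfPolynomials_eq_det_vandermonde x
    (fun i : Fin n => Polynomial.C ((2 : ℝ) ^ (i : ℕ))⁻¹ * hermiteH i)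
    (fun i => by rw [Polynomial.natDegree_C_mul (by positivity), hermiteH_natDegree])
    (fun i => by
      rw [Polynomial.Monic, Polynomial.leadingCoeff_mul, hermiteH_leadingCoeff,
        Polynomial.leadingCoeff_C, inv_mul_cancel₀ (by positivity)])
  rw [h, ← Matrix.det_transpose, ← Matrix.det_mul_row]
  congr 1
  ext i j
  simp

lemma vdm_eq_vandermonde (n : ℕ) (x : Fin n → ℝ) :
    Matrix.det (Matrix.vandermonde x) = (∏ i : Fin n, ∏ _j ∈ Finset.Ioi i, (-1 : ℝ)) * vdm n x := by
  rw [Matrix.det_vandermonde, vdm, ← Finset.prod_mul_distrib]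
  refine Finset.prod_congr rfl fun i _ => ?_
  rw [← Finset.prod_mul_distrib]
  exact Finset.prod_congr rfl fun j _ => by ring

lemma exists_slater_eq (n : ℕ) : ∃ B : ℝ, B ≠ 0 ∧ ∀ x : Fin n → ℝ,
    slater n x = B * Real.exp (-(∑ i, x i ^ 2) / 2) * vdm n x := by
  refine ⟨(∏ i : Fin n, normConst i) * (∏ i : Fin n, (2 : ℝ) ^ (i : ℕ)) *
    ∏ i : Fin n, ∏ _j ∈ Finset.Ioi i, (-1 : ℝ), ?_, fun x => ?_⟩
  · refine mul_ne_zero (mul_ne_zero ?_ ?_) ?_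
    · exact Finset.prod_ne_zero_iff.2 fun i _ => (normConst_pos _).ne'
    · exact Finset.prod_ne_zero_iff.2 fun i _ => by positivity
    · exact Finset.prod_ne_zero_iff.2 fun i _ => Finset.prod_ne_zero_iff.2 fun j _ => by norm_num
  · have e : (Matrix.of fun i j : Fin n => hermiteFun i (x j)) = Matrix.of fun i j : Fin n =>
        normConst i * (Matrix.of fun i j : Fin n => Real.exp (-x j ^ 2 / 2) *
          (Matrix.of fun i j : Fin n => (hermiteH i).eval (x j)) i j) i j := by
      ext i j; simp [hermiteFun]; ring
    rw [slater, e, Matrix.det_mul_column (fun i : Fin n => normConst i), Matrix.det_mul_row, det_hermiteH, vdm_eq_vandermonde,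
      prod_gaussian]
    ring

lemma vdm_ne_zero_iff {n : ℕ} {x : Fin n → ℝ} : vdm n x ≠ 0 ↔ Function.Injective x := by
  rw [← Matrix.det_vandermonde_ne_zero_iff, vdm_eq_vandermonde]
  have : (∏ i : Fin n, ∏ _j ∈ Finset.Ioi i, (-1 : ℝ)) ≠ 0 :=
    Finset.prod_ne_zero_iff.2 fun i _ => Finset.prod_ne_zero_iff.2 fun j _ => by norm_num
  rw [ne_eq, ne_eq, mul_eq_zero, not_or, and_iff_right this]

lemma slater_ne_zero_iff {n : ℕ} {x : Fin n → ℝ} : slater n x ≠ 0 ↔ Function.Injective x := by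
  obtain ⟨B, hB, h⟩ := exists_slater_eq n
  rw [h, ← vdm_ne_zero_iff]
  simp [hB, (Real.exp_pos _).ne']

lemma vdm_snoc {m : ℕ} (c : Fin m → ℝ) (x : ℝ) :
    vdm (m + 1) (Fin.snoc (α := fun _ => ℝ) c x) = vdm m c * ∏ j, (c j - x) := by
  -- Writing the products over `j > i` as full products with a conditional lets the last index be
  -- split off in both variables.
  have hf (i : Fin (m + 1)) (f : Fin (m + 1) → ℝ) :
      ∏ j ∈ Finset.Ioi i, f j = ∏ j, if i < j then f j else 1 := by
    rw [← Finset.prod_filter]; congr 1; ext; simp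
  have hf' (i : Fin m) (f : Fin m → ℝ) :
      ∏ j ∈ Finset.Ioi i, f j = ∏ j, if i < j then f j else 1 := by
    rw [← Finset.prod_filter]; congr 1; ext; simp
  simp only [vdm, hf, hf']
  rw [Fin.prod_univ_castSucc]
  simp only [Fin.prod_univ_castSucc, Fin.snoc_castSucc, Fin.snoc_last, Fin.castSucc_lt_castSucc_iff,
    Fin.castSucc_lt_last, if_true, lt_irrefl, if_false, mul_one]
  rw [Finset.prod_mul_distrib]
  simp [Fin.not_lt.2 (Fin.le_last _)]

/-! ### Zeros -/

lemma exists_slater_snoc_eq {m : ℕ} {c : Fin m → ℝ} (hc : Function.Injective c) :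
    ∃ A : ℝ, A ≠ 0 ∧ ∀ x : ℝ, slater (m + 1) (Fin.snoc (α := fun _ => ℝ) c x)
      = A * Real.exp (-x ^ 2 / 2) * ∏ j, (x - c j) := by
  obtain ⟨B, hB, h⟩ := exists_slater_eq (m + 1)
  refine ⟨B * Real.exp (-(∑ j, c j ^ 2) / 2) * vdm m c * (-1) ^ m, ?_, fun x => ?_⟩
  · have := vdm_ne_zero_iff.2 hc
    have h2 := (Real.exp_pos (-(∑ j, c j ^ 2) / 2)).ne'
    have h3 : (-1 : ℝ) ^ m ≠ 0 := pow_ne_zero _ (by norm_num)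
    simp only [ne_eq, mul_eq_zero, not_or]; tauto
  · rw [h, vdm_snoc, Fin.sum_univ_castSucc]
    simp only [Fin.snoc_castSucc, Fin.snoc_last]
    have e1 : Real.exp (-(∑ j, c j ^ 2 + x ^ 2) / 2)
        = Real.exp (-(∑ j, c j ^ 2) / 2) * Real.exp (-x ^ 2 / 2) := by
      rw [← Real.exp_add]; congr 1; ring
    have e2 : ∏ j, (c j - x) = (-1) ^ m * ∏ j, (x - c j) := by
      have : (-1 : ℝ) ^ m = ∏ _j : Fin m, (-1) := by simp
      rw [this, ← Finset.prod_mul_distrib]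
      exact Finset.prod_congr rfl fun j _ => by ring
    rw [e1, e2]; ring

lemma zeros_slater_snoc {m : ℕ} {c : Fin m → ℝ} (hc : Function.Injective c) :
    {x : ℝ | slater (m + 1) (Fin.snoc (α := fun _ => ℝ) c x) = 0} = Set.range c := by
  obtain ⟨A, hA, h⟩ := exists_slater_snoc_eq hc
  ext x
  simp only [h, mem_ofPred_eq, mul_eq_zero, hA, (Real.exp_pos _).ne', false_or, or_self,
    Finset.prod_eq_zero_iff, Finset.mem_univ, true_and, sub_eq_zero, mem_range]
  exact exists_congr fun _ => eq_comm

lemma analyticOrderAt_slater_snoc {m : ℕ} {c : Fin m → ℝ} (hc : Function.Injective c) (j : Fin m) :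
    analyticOrderAt (fun x : ℝ => slater (m + 1) (Fin.snoc (α := fun _ => ℝ) c x)) (c j) = 1 := by
  obtain ⟨A, hA, h⟩ := exists_slater_snoc_eq hc
  simp only [h]
  rw [show (1 : ℕ∞) = ((1 : ℕ) : ℕ∞) from rfl, AnalyticAt.analyticOrderAt_eq_natCast (by fun_prop)]
  -- The cofactor left after removing the factor `x - c j` is nonzero at `c j` because the points
  -- are distinct.
  refine ⟨fun x => A * Real.exp (-x ^ 2 / 2) * ∏ i ∈ Finset.univ.erase j, (x - c i), by fun_prop,
    ?_, Eventually.of_forall fun x => ?_⟩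
  · refine mul_ne_zero (mul_ne_zero hA (Real.exp_pos _).ne') (Finset.prod_ne_zero_iff.2 ?_)
    intro i hi
    exact sub_ne_zero.2 fun h => (Finset.mem_erase.1 hi).1 (hc h.symm)
  · rw [← Finset.mul_prod_erase _ _ (Finset.mem_univ j), smul_eq_mul]; ring

/-- Adjoining one more point outside the range of `c` gives a square Slater matrix with nonzero
determinant; the vectors in question are its first `m` columns. -/
lemma linearIndependent_hVec {m : ℕ} {c : Fin m → ℝ} (hc : Function.Injective c) :
    LinearIndependent ℝ (fun j : Fin m => hVec (m + 1) (c j)) := by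
  obtain ⟨x, hx⟩ := (Set.finite_range c).exists_notMem
  have hinj : Function.Injective (Fin.snoc (α := fun _ => ℝ) c x : Fin (m + 1) → ℝ) :=
    Fin.snoc_injective_iff.2 ⟨hc, hx⟩
  have h := Matrix.linearIndependent_cols_of_det_ne_zero (slater_ne_zero_iff.2 hinj)
  have h2 := h.comp _ (Fin.castSucc_injective m)
  have e : (fun j : Fin m => hVec (m + 1) (c j)) =
      (Matrix.of fun i j : Fin (m + 1) => hermiteFun i
        ((Fin.snoc c x : Fin (m + 1) → ℝ) j)).col ∘ Fin.castSucc := by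
    ext j i
    simp [hVec, Matrix.col_apply]
  rw [e]
  exact h2

/-- The polynomial factor of `linComb b`. -/
noncomputable def linCombPoly {n : ℕ} (b : Fin n → ℝ) : Polynomial ℝ :=
  ∑ j, Polynomial.C (b j * normConst j) * hermiteH j

lemma linComb_eq {n : ℕ} (b : Fin n → ℝ) (x : ℝ) :
    linComb b x = (linCombPoly b).eval x * Real.exp (-x ^ 2 / 2) := by
  rw [linComb, linCombPoly, Polynomial.eval_finsetSum, Finset.sum_mul]
  exact Finset.sum_congr rfl fun j _ => by simp [hermiteFun]; ring

lemma linCombPoly_natDegree_le {m : ℕ} (b : Fin (m + 1) → ℝ) : (linCombPoly b).natDegree ≤ m := by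
  refine Polynomial.natDegree_sum_le_of_forall_le _ _ fun j _ => ?_
  refine (Polynomial.natDegree_C_mul_le _ _).trans ?_
  rw [hermiteH_natDegree]; omega

/-- If the polynomial vanished, `b` would give a relation between the rows of the Slater matrix at
the distinct points `0, …, m`, which is nonsingular. -/
lemma linCombPoly_ne_zero {m : ℕ} {b : Fin (m + 1) → ℝ} (hb : b ≠ 0) : linCombPoly b ≠ 0 := by
  intro h
  set x : Fin (m + 1) → ℝ := fun i => (i : ℝ)
  have hx : Function.Injective x := fun i j hij => by simpa [x, Fin.ext_iff] using hij
  have hli := Matrix.linearIndependent_rows_of_det_ne_zero (slater_ne_zero_iff.2 hx)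
  rw [Fintype.linearIndependent_iff] at hli
  refine hb (funext (hli b ?_))
  ext j
  have := linComb_eq b (x j)
  rw [h, Polynomial.eval_zero, zero_mul] at this
  simpa [linComb, Matrix.row] using this

lemma zeros_linComb {n : ℕ} {b : Fin n → ℝ} (hb : linCombPoly b ≠ 0) :
    {x : ℝ | linComb b x = 0} = ((linCombPoly b).roots.toFinset : Set ℝ) := by
  ext x
  simp [linComb_eq, hb]

lemma encard_zeros_linComb_le {m : ℕ} {b : Fin (m + 1) → ℝ} (hb : b ≠ 0) :
    {x : ℝ | linComb b x = 0}.encard ≤ m := by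
  rw [zeros_linComb (linCombPoly_ne_zero hb), Set.encard_coe_eq_coe_finsetCard]
  exact_mod_cast (Multiset.toFinset_card_le _).trans
    ((Polynomial.card_roots' _).trans (linCombPoly_natDegree_le b))

/-- The polynomial factor is divisible by the monic `∏ (X - c j)` of degree `m` and itself has
degree at most `m`, so the quotient is a nonzero constant. -/
lemma linComb_eq_slater {m : ℕ} {b : Fin (m + 1) → ℝ} (hb : b ≠ 0) {c : Fin m → ℝ}
    (hc : Function.Injective c) (hz : {x : ℝ | linComb b x = 0} = Set.range c) :
    ∃ C : ℝ, C ≠ 0 ∧ ∀ x : ℝ,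
      linComb b x = C * slater (m + 1) (Fin.snoc (α := fun _ => ℝ) c x) := by
  obtain ⟨A, hA, h⟩ := exists_slater_snoc_eq hc
  have hp := linCombPoly_ne_zero hb
  set p := linCombPoly b
  have hdvd : ∏ j, (Polynomial.X - Polynomial.C (c j)) ∣ p := by
    refine Finset.prod_dvd_of_coprime ?_ fun j _ => ?_
    · intro i _ j _ hij
      exact Polynomial.isCoprime_X_sub_C_of_isUnit_sub (sub_ne_zero.2 fun h => hij (hc h)).isUnit
    · rw [Polynomial.dvd_iff_isRoot, Polynomial.IsRoot.def]
      have : c j ∈ {x : ℝ | linComb b x = 0} := hz ▸ Set.mem_range_self j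
      simpa [linComb_eq, (Real.exp_pos _).ne'] using this
  obtain ⟨q, hq⟩ := hdvd
  have hq0 : q ≠ 0 := by rintro rfl; exact hp (by simpa using hq)
  have hm : (∏ j, (Polynomial.X - Polynomial.C (c j))).Monic :=
    Polynomial.monic_prod_of_monic _ _ fun j _ => Polynomial.monic_X_sub_C _
  have hdeg : q.natDegree = 0 := by
    have h1 := linCombPoly_natDegree_le b
    have h2 : (linCombPoly b).natDegree = _ := congrArg _ hq
    rw [hm.natDegree_mul' hq0, Polynomial.natDegree_prod _ _
      (fun j _ => Polynomial.X_sub_C_ne_zero _)] at h2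
    simp at h2
    omega
  obtain ⟨d, rfl⟩ := Polynomial.natDegree_eq_zero.1 hdeg
  have hd : d ≠ 0 := by simpa using hq0
  refine ⟨d / A, div_ne_zero hd hA, fun x => ?_⟩
  rw [h, linComb_eq, show linCombPoly b = _ from hq]
  simp [Polynomial.eval_prod]
  field_simp

/-! ### The eigenvalue equation -/

open Polynomial in
lemma hermiteH_ode (m : ℕ) :
    derivative (derivative (hermiteH m))
      = 2 * X * derivative (hermiteH m) - C (2 * (m : ℝ)) * hermiteH m := by
  induction m with
  | zero => simp [hermiteH]
  | succ m ih =>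
    -- The equation at level `m` yields the lowering relation `H_{m+1}' = 2 (m + 1) H_m`;
    -- differentiating it and inserting the recursion gives level `m + 1`.
    have h1 : derivative (hermiteH (m + 1)) = C (2 * ((m : ℝ) + 1)) * hermiteH m := by
      rw [hermiteH, derivative_sub, ih]
      have h2 : (C (2 : ℝ) : ℝ[X]) = 2 := rfl
      simp only [C_mul, C_add, C_1, h2, derivative_mul, derivative_X, derivative_ofNat]
      ring
    rw [h1, derivative_C_mul, hermiteH]
    push_cast
    ring

lemma contDiff_hermiteFun (m : ℕ) : ContDiff ℝ ∞ (hermiteFun m) := by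
  have : ContDiff ℝ ∞ fun x : ℝ => (hermiteH m).eval x := by
    simpa using Polynomial.contDiff_aeval (𝕜 := ℝ) (hermiteH m) ∞
  unfold hermiteFun
  fun_prop

lemma hasDerivAt_poly_mul_gaussian (p : Polynomial ℝ) (x : ℝ) :
    HasDerivAt (fun x : ℝ => p.eval x * Real.exp (-x ^ 2 / 2))
      ((Polynomial.derivative p - Polynomial.X * p).eval x * Real.exp (-x ^ 2 / 2)) x := by
  have h1 : HasDerivAt (fun x : ℝ => -x ^ 2 / 2) (-x) x := by
    have := ((hasDerivAt_pow 2 x).neg).div_const 2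
    exact this.congr_deriv (by simp; ring)
  exact ((p.hasDerivAt x).mul h1.exp).congr_deriv (by simp; ring)

lemma deriv_deriv_hermiteFun (m : ℕ) (x : ℝ) :
    deriv (deriv (hermiteFun m)) x = (x ^ 2 - (2 * m + 1)) * hermiteFun m x := by
  have h0 (p : Polynomial ℝ) : HasDerivAt (fun x : ℝ => normConst m *
      (p.eval x * Real.exp (-x ^ 2 / 2))) (normConst m *
      ((Polynomial.derivative p - Polynomial.X * p).eval x * Real.exp (-x ^ 2 / 2))) x :=
    (hasDerivAt_poly_mul_gaussian p x).const_mul _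
  have e : hermiteFun m = fun x => normConst m *
      ((hermiteH m).eval x * Real.exp (-x ^ 2 / 2)) := by
    ext x; rw [hermiteFun]; ring
  have e1 : deriv (hermiteFun m) = fun x => normConst m * ((Polynomial.derivative (hermiteH m)
      - Polynomial.X * hermiteH m).eval x * Real.exp (-x ^ 2 / 2)) := by
    ext x
    rw [e]
    exact ((hasDerivAt_poly_mul_gaussian _ x).const_mul _).deriv
  rw [e1, (h0 _).deriv, e, Polynomial.derivative_sub, hermiteH_ode]
  simp
  ring

lemma hasFDerivAt_prod_coord {n : ℕ} {f : Fin n → ℝ → ℝ} (hf : ∀ k, Differentiable ℝ (f k))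
    (x : EuclideanSpace ℝ (Fin n)) :
    HasFDerivAt (fun x : EuclideanSpace ℝ (Fin n) => ∏ k, f k (x k))
      (∑ i, (∏ k ∈ Finset.univ.erase i, f k (x k)) • (deriv (f i) (x i) •
        (EuclideanSpace.proj i : EuclideanSpace ℝ (Fin n) →L[ℝ] ℝ))) x := by
  refine HasFDerivAt.finsetProd fun i _ => ?_
  exact (hf i (x i)).hasDerivAt.comp_hasFDerivAt x
    (EuclideanSpace.proj i : EuclideanSpace ℝ (Fin n) →L[ℝ] ℝ).hasFDerivAt

/-- Expressing the partial derivative with `Function.update` keeps it a product of one-variable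
functions, so the same lemma gives the second derivative. -/
lemma fderiv_prod_coord {n : ℕ} {f : Fin n → ℝ → ℝ} (hf : ∀ k, Differentiable ℝ (f k))
    (x : EuclideanSpace ℝ (Fin n)) (j : Fin n) :
    fderiv ℝ (fun x : EuclideanSpace ℝ (Fin n) => ∏ k, f k (x k)) x (EuclideanSpace.single j 1)
      = ∏ k, Function.update f j (deriv (f j)) k (x k) := by
  rw [(hasFDerivAt_prod_coord hf x).fderiv, sum_apply,
    Finset.sum_eq_single j (fun i _ hi => by simp [hi]) (by simp),
    ← Finset.mul_prod_erase Finset.univ _ (Finset.mem_univ j)]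
  simp only [smul_apply, Function.update_self]
  have e : ∏ k ∈ Finset.univ.erase j, Function.update f j (deriv (f j)) k (x k)
      = ∏ k ∈ Finset.univ.erase j, f k (x k) :=
    Finset.prod_congr rfl fun k hk => by rw [Function.update_of_ne (Finset.ne_of_mem_erase hk)]
  rw [e]
  simp [mul_comm]

/-- The Slater determinant as a function on Euclidean space. -/
noncomputable def slaterE (n : ℕ) (x : EuclideanSpace ℝ (Fin n)) : ℝ := slater n (fun i => x i)

/-- The eigenvalue `1 + 3 + ⋯ + (2 n - 1)`. -/
noncomputable def slaterEigenvalue (n : ℕ) : ℝ := ∑ j : Fin n, (2 * (j : ℝ) + 1)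

lemma slaterE_eq_sum (n : ℕ) : slaterE n = fun x => ∑ σ : Equiv.Perm (Fin n),
    ((Equiv.Perm.sign σ : ℤ) : ℝ) * ∏ k, hermiteFun (σ k) (x k) := by
  ext x
  rw [slaterE, slater, Matrix.det_apply']
  rfl

lemma contDiff_prod_coord {n : ℕ} {f : Fin n → ℝ → ℝ} (hf : ∀ k, ContDiff ℝ ∞ (f k)) :
    ContDiff ℝ ∞ (fun x : EuclideanSpace ℝ (Fin n) => ∏ k, f k (x k)) :=
  contDiff_prod fun k _ => (hf k).comp
    (EuclideanSpace.proj k : EuclideanSpace ℝ (Fin n) →L[ℝ] ℝ).contDiff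

lemma contDiff_slaterE (n : ℕ) : ContDiff ℝ ∞ (slaterE n) := by
  rw [slaterE_eq_sum]
  exact ContDiff.sum fun σ _ => contDiff_const.mul
    (contDiff_prod_coord fun k => contDiff_hermiteFun _)

lemma differentiable_deriv_hermiteFun (m : ℕ) : Differentiable ℝ (deriv (hermiteFun m)) :=
  ((contDiff_hermiteFun m).of_le (m := 2)
    (WithTop.coe_le_coe.2 (le_top : (2 : ℕ∞) ≤ ⊤))).differentiable_deriv_two

lemma fderiv_slaterE (n : ℕ) (j : Fin n) (x : EuclideanSpace ℝ (Fin n)) :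
    fderiv ℝ (slaterE n) x (EuclideanSpace.single j 1) = ∑ σ : Equiv.Perm (Fin n),
      ((Equiv.Perm.sign σ : ℤ) : ℝ) * ∏ k, Function.update (fun k => hermiteFun (σ k)) j
        (deriv (hermiteFun (σ j))) k (x k) := by
  have hd (σ : Equiv.Perm (Fin n)) (k : Fin n) : Differentiable ℝ (hermiteFun (σ k)) :=
    (contDiff_hermiteFun _).differentiable (by simp)
  rw [slaterE_eq_sum, fderiv_fun_sum fun σ _ =>
    ((hasFDerivAt_prod_coord (hd σ) x).differentiableAt.const_mul _), sum_apply]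
  refine Finset.sum_congr rfl fun σ _ => ?_
  rw [fderiv_const_mul (hasFDerivAt_prod_coord (hd σ) x).differentiableAt,
    smul_apply, fderiv_prod_coord (hd σ), smul_eq_mul]

lemma fderiv_fderiv_slaterE (n : ℕ) (j : Fin n) (x : EuclideanSpace ℝ (Fin n)) :
    fderiv ℝ (fun y => fderiv ℝ (slaterE n) y (EuclideanSpace.single j 1)) x
      (EuclideanSpace.single j 1) = ∑ σ : Equiv.Perm (Fin n),
      (x j ^ 2 - (2 * (σ j : ℕ) + 1)) * (((Equiv.Perm.sign σ : ℤ) : ℝ) *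
        ∏ k, hermiteFun (σ k) (x k)) := by
  have hd (σ : Equiv.Perm (Fin n)) (k : Fin n) : Differentiable ℝ
      (Function.update (fun k : Fin n => hermiteFun (σ k)) j (deriv (hermiteFun (σ j))) k) := by
    rcases eq_or_ne k j with rfl | hk
    · rw [Function.update_self]; exact differentiable_deriv_hermiteFun _
    · rw [Function.update_of_ne hk]; exact (contDiff_hermiteFun _).differentiable (by simp)
  simp only [fderiv_slaterE]
  rw [fderiv_fun_sum fun σ _ =>
    ((hasFDerivAt_prod_coord (hd σ) x).differentiableAt.const_mul _), sum_apply]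
  refine Finset.sum_congr rfl fun σ _ => ?_
  rw [fderiv_const_mul (hasFDerivAt_prod_coord (hd σ) x).differentiableAt,
    smul_apply, fderiv_prod_coord (hd σ), smul_eq_mul, Function.update_self,
    Function.update_idem, mul_left_comm]
  congr 1
  rw [← Finset.mul_prod_erase Finset.univ _ (Finset.mem_univ j), Function.update_self,
    deriv_deriv_hermiteFun, ← Finset.mul_prod_erase Finset.univ _ (Finset.mem_univ j),
    Finset.prod_congr rfl (g := fun k => hermiteFun (σ k) (x k)) fun k hk => by
      rw [Function.update_of_ne (Finset.ne_of_mem_erase hk)]]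
  ring

/-- In the term of `σ` the energies add up to `∑ j, (2 σ(j) + 1)`, which does not depend on `σ`; so
the common factor comes out of the sum. -/
lemma laplacian_slaterE (n : ℕ) (x : EuclideanSpace ℝ (Fin n)) :
    ∑ j, fderiv ℝ (fun y => fderiv ℝ (slaterE n) y (EuclideanSpace.single j 1)) x
      (EuclideanSpace.single j 1) = (‖x‖ ^ 2 - slaterEigenvalue n) * slaterE n x := by
  simp only [fderiv_fderiv_slaterE]
  rw [Finset.sum_comm, slaterE_eq_sum, Finset.mul_sum]
  refine Finset.sum_congr rfl fun σ _ => ?_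
  rw [← Finset.sum_mul, Finset.sum_sub_distrib, EuclideanSpace.real_norm_sq_eq, slaterEigenvalue,
    Equiv.sum_comp σ (fun j : Fin n => 2 * ((j : ℕ) : ℝ) + 1)]

/-! ### The weak equation -/

section Test

variable {n : ℕ} {φ : EuclideanSpace ℝ (Fin n) → ℝ}

lemma measurableSet_chamber (n : ℕ) : MeasurableSet (chamber n) := by
  have : chamber n = ⋂ (i : Fin n) (j : Fin n) (_ : i < j), {x | x i < x j} := by
    ext; simp [chamber]
  rw [this]
  refine MeasurableSet.iInter fun i => MeasurableSet.iInter fun j => MeasurableSet.iInter fun _ => ?_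
  exact measurableSet_lt (by fun_prop) (by fun_prop)

lemma isOpen_chamber (n : ℕ) : IsOpen (chamber n) := by
  have : chamber n = ⋂ (i : Fin n) (j : Fin n) (_ : i < j), {x | x i < x j} := by
    ext; simp [chamber]
  rw [this]
  refine isOpen_iInter_of_finite fun i => isOpen_iInter_of_finite fun j =>
    isOpen_iInter_of_finite fun _ => ?_
  exact isOpen_lt (by fun_prop) (by fun_prop)

lemma continuous_gradient {u : EuclideanSpace ℝ (Fin n) → ℝ} (hu : ContDiff ℝ ∞ u) :
    Continuous (gradient u) := by
  unfold gradient
  exact (InnerProductSpace.toDual ℝ _).symm.continuous.comp (hu.continuous_fderiv (by simp))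

lemma support_gradient_subset (u : EuclideanSpace ℝ (Fin n) → ℝ) :
    Function.support (gradient u) ⊆ tsupport u := by
  intro x hx
  refine support_fderiv_subset ℝ (f := u) ?_
  intro h
  exact hx (by simp [gradient, h])

lemma inner_gradient_gradient (u φ : EuclideanSpace ℝ (Fin n) → ℝ) (x : EuclideanSpace ℝ (Fin n)) :
    inner ℝ (gradient u x) (gradient φ x) = ∑ j, fderiv ℝ u x (EuclideanSpace.single j 1) *
      fderiv ℝ φ x (EuclideanSpace.single j 1) := by
  rw [← (EuclideanSpace.basisFun (Fin n) ℝ).sum_inner_mul_inner]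
  refine Finset.sum_congr rfl fun j _ => ?_
  rw [real_inner_comm (gradient φ x)]
  simp [gradient, InnerProductSpace.toDual_symm_apply]

lemma IsTest.eq_zero (h : IsTest n φ) {x : EuclideanSpace ℝ (Fin n)} (hx : x ∉ chamber n) :
    φ x = 0 := image_eq_zero_of_notMem_tsupport fun h' => hx (h.support h')

lemma IsTest.gradient_eq_zero (h : IsTest n φ) {x : EuclideanSpace ℝ (Fin n)}
    (hx : x ∉ chamber n) : gradient φ x = 0 :=
  Function.notMem_support.1 fun h' => hx (h.support (support_gradient_subset φ h'))

lemma IsTest.hasCompactSupport_gradient (h : IsTest n φ) : HasCompactSupport (gradient φ) :=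
  h.compact.mono' (support_gradient_subset φ)

/-- Since `φ` is supported in the chamber, the integrals extend to the whole space, where the Slater
determinant is smooth and integration by parts has no boundary term. -/
lemma weak_equation_slaterE (h : IsTest n φ) :
    ∫ x, (inner ℝ (gradient (slaterE n) x) (gradient φ x) + ‖x‖ ^ 2 * slaterE n x * φ x)
        ∂(chamberMeasure n)
      = slaterEigenvalue n * ∫ x, slaterE n x * φ x ∂(chamberMeasure n) := by
  rw [chamberMeasure, setIntegral_eq_integral_of_forall_compl_eq_zero fun x hx => by
      rw [h.eq_zero hx, h.gradient_eq_zero hx]; simp,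
    setIntegral_eq_integral_of_forall_compl_eq_zero fun x hx => by rw [h.eq_zero hx]; simp]
  have hU := contDiff_slaterE n
  have hUc : Continuous (slaterE n) := hU.continuous
  have hφc : Continuous φ := h.smooth.continuous
  have hv (j : Fin n) : ContDiff ℝ ∞
      (fun y => fderiv ℝ (slaterE n) y (EuclideanSpace.single j 1)) :=
    (hU.fderiv_right (m := ∞) (by simp)).clm_apply contDiff_const
  have hφd (j : Fin n) : Continuous fun x => fderiv ℝ φ x (EuclideanSpace.single j 1) :=
    (h.smooth.continuous_fderiv (by simp)).clm_apply continuous_const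
  have hvd (j : Fin n) : Continuous fun x =>
      fderiv ℝ (fun y => fderiv ℝ (slaterE n) y (EuclideanSpace.single j 1)) x
        (EuclideanSpace.single j 1) :=
    ((hv j).continuous_fderiv (by simp)).clm_apply continuous_const
  have i1 (j : Fin n) : Integrable fun x => fderiv ℝ (slaterE n) x (EuclideanSpace.single j 1) *
      fderiv ℝ φ x (EuclideanSpace.single j 1) :=
    ((hv j).continuous.mul (hφd j)).integrable_of_hasCompactSupport
      ((h.compact.fderiv_apply ℝ _).mul_left)
  have i2 (j : Fin n) : Integrable fun x =>
      fderiv ℝ (fun y => fderiv ℝ (slaterE n) y (EuclideanSpace.single j 1)) x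
        (EuclideanSpace.single j 1) * φ x :=
    ((hvd j).mul hφc).integrable_of_hasCompactSupport h.compact.mul_left
  have i3 (j : Fin n) : Integrable fun x =>
      fderiv ℝ (slaterE n) x (EuclideanSpace.single j 1) * φ x :=
    ((hv j).continuous.mul hφc).integrable_of_hasCompactSupport h.compact.mul_left
  have i4 : Integrable fun x => ‖x‖ ^ 2 * slaterE n x * φ x :=
    (by fun_prop : Continuous fun x => ‖x‖ ^ 2 * slaterE n x * φ x).integrable_of_hasCompactSupport
      h.compact.mul_left
  have hparts (j : Fin n) := integral_mul_fderiv_eq_neg_fderiv_mul_of_integrable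
    (i2 j) (i1 j) (i3 j) (fun x _ => (hv j).differentiable (by simp) x)
    (fun x _ => h.smooth.differentiable (by simp) x)
  simp only [inner_gradient_gradient]
  rw [integral_add (integrable_finsetSum _ fun j _ => i1 j) i4,
    integral_finsetSum _ fun j _ => i1 j]
  simp only [hparts]
  rw [Finset.sum_neg_distrib, ← integral_finsetSum _ fun j _ => i2 j, neg_add_eq_sub,
    ← integral_sub i4 (integrable_finsetSum _ fun j _ => i2 j), ← integral_const_mul]
  congr 1
  ext x
  rw [← Finset.sum_mul, laplacian_slaterE]
  ring

end Test

section Approximation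

/-! ### Integrability of the Slater determinant -/

lemma hasTemperateGrowth_vdm (n : ℕ) : Function.HasTemperateGrowth
    (fun x : EuclideanSpace ℝ (Fin n) => vdm n (fun i => x i)) := by
  have hprod {ι : Type} (s : Finset ι) (f : ι → EuclideanSpace ℝ (Fin n) → ℝ)
      (hf : ∀ i ∈ s, (f i).HasTemperateGrowth) : (∏ i ∈ s, f i).HasTemperateGrowth :=
    Finset.prod_induction f Function.HasTemperateGrowth (fun _ _ ha hb => ha.mul hb)
      (Function.HasTemperateGrowth.const 1) hf
  have hc (i : Fin n) : Function.HasTemperateGrowth fun x : EuclideanSpace ℝ (Fin n) => x i :=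
    (EuclideanSpace.proj i : EuclideanSpace ℝ (Fin n) →L[ℝ] ℝ).hasTemperateGrowth
  have e : (fun x : EuclideanSpace ℝ (Fin n) => vdm n (fun i => x i))
      = ∏ i, ∏ j ∈ Finset.Ioi i, fun x : EuclideanSpace ℝ (Fin n) => x i - x j := by
    ext x; simp [vdm, Finset.prod_apply]
  rw [e]
  exact hprod _ _ fun i _ => hprod _ _ fun j _ => (hc i).sub (hc j)

lemma exists_slaterE_eq (n : ℕ) : ∃ B : ℝ, B ≠ 0 ∧ ∀ x : EuclideanSpace ℝ (Fin n),
    slater n (fun i => x i) = B * Real.exp (-‖x‖ ^ 2 / 2) * vdm n (fun i => x i) := by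
  obtain ⟨B, hB, h⟩ := exists_slater_eq n
  exact ⟨B, hB, fun x => by rw [h, EuclideanSpace.real_norm_sq_eq]⟩

lemma norm_gradient (n : ℕ) (u : EuclideanSpace ℝ (Fin n) → ℝ) (x : EuclideanSpace ℝ (Fin n)) :
    ‖gradient u x‖ = ‖fderiv ℝ u x‖ := LinearIsometryEquiv.norm_map _ _

lemma exists_slaterE_bound (n : ℕ) : ∃ (C : ℝ) (k : ℕ), 0 ≤ C ∧ ∀ x : EuclideanSpace ℝ (Fin n),
    ‖slaterE n x‖ ≤ C * (1 + ‖x‖) ^ k * Real.exp (-‖x‖ ^ 2 / 2) ∧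
    ‖gradient (slaterE n) x‖ ≤ C * (1 + ‖x‖) ^ k * Real.exp (-‖x‖ ^ 2 / 2) := by
  obtain ⟨B, hB, hU⟩ := exists_slaterE_eq n
  have hV := hasTemperateGrowth_vdm n
  obtain ⟨k, C, hC, hb⟩ := hV.norm_iteratedFDeriv_le_uniform 1
  set V := fun x : EuclideanSpace ℝ (Fin n) => vdm n (fun i => x i)
  have h0 (x) : ‖V x‖ ≤ C * (1 + ‖x‖) ^ k := by simpa using hb 0 (by simp) x
  have h1 (x) : ‖fderiv ℝ V x‖ ≤ C * (1 + ‖x‖) ^ k := by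
    simpa [norm_iteratedFDeriv_one] using hb 1 le_rfl x
  have hle (x : EuclideanSpace ℝ (Fin n)) :
      C * (1 + ‖x‖) ^ k ≤ C * (1 + ‖x‖) ^ (k + 1) := by
    gcongr
    · linarith [norm_nonneg x]
    · omega
  -- The gradient of `exp (-‖x‖² / 2) * V` is `exp (-‖x‖² / 2)` times `∇V - V x`: two terms, hence
  -- `C + C`, and the factor `x` costs one more power.
  refine ⟨|B| * (C + C), k + 1, by positivity, fun x => ⟨?_, ?_⟩⟩
  · rw [slaterE, hU, norm_mul, norm_mul, Real.norm_of_nonneg (Real.exp_pos _).le, Real.norm_eq_abs]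
    have := (h0 x).trans (hle x)
    calc |B| * Real.exp (-‖x‖ ^ 2 / 2) * ‖V x‖
        ≤ |B| * Real.exp (-‖x‖ ^ 2 / 2) * (C * (1 + ‖x‖) ^ (k + 1)) := by gcongr
      _ ≤ |B| * Real.exp (-‖x‖ ^ 2 / 2) *
          (C * (1 + ‖x‖) ^ (k + 1) + C * (1 + ‖x‖) ^ (k + 1)) := by
        gcongr
        exact le_add_of_nonneg_left (by positivity)
      _ = _ := by ring
  · have hg : HasFDerivAt (fun x : EuclideanSpace ℝ (Fin n) => -‖x‖ ^ 2 / 2) (-innerSL ℝ x) x := by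
      have h := (hasStrictFDerivAt_norm_sq x).hasFDerivAt.const_mul (-1 / 2 : ℝ)
      refine (h.congr_fderiv ?_).congr_of_eventuallyEq (Eventually.of_forall fun y => by ring)
      ext y
      simp
      ring
    have hf : HasFDerivAt (slaterE n) ((B * Real.exp (-‖x‖ ^ 2 / 2)) •
        (fderiv ℝ V x - V x • innerSL ℝ x)) x := by
      have h := (hg.exp.const_mul B).mul (hV.1.differentiable (by simp) x).hasFDerivAt
      refine (h.congr_fderiv ?_).congr_of_eventuallyEq (Eventually.of_forall fun y => hU y)
      ext y
      simp [V]
      ring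
    rw [norm_gradient, hf.fderiv, norm_smul, norm_mul, Real.norm_of_nonneg (Real.exp_pos _).le,
      Real.norm_eq_abs]
    have h2 : ‖fderiv ℝ V x - V x • innerSL ℝ x‖ ≤
        C * (1 + ‖x‖) ^ (k + 1) + C * (1 + ‖x‖) ^ (k + 1) := by
      refine (norm_sub_le _ _).trans (add_le_add ((h1 x).trans (hle x)) ?_)
      rw [norm_smul, innerSL_apply_norm, pow_succ, ← mul_assoc]
      gcongr
      · exact h0 x
      · linarith
    calc |B| * Real.exp (-‖x‖ ^ 2 / 2) * ‖fderiv ℝ V x - V x • innerSL ℝ x‖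
        ≤ |B| * Real.exp (-‖x‖ ^ 2 / 2) *
          (C * (1 + ‖x‖) ^ (k + 1) + C * (1 + ‖x‖) ^ (k + 1)) := by gcongr
      _ = _ := by ring

lemma memLp_slaterE (n : ℕ) : MemLp (slaterE n) 2 (chamberMeasure n) := by
  obtain ⟨C, k, -, h⟩ := exists_slaterE_bound n
  exact (memLp_two_of_gaussian_bound volume (contDiff_slaterE n).continuous.aestronglyMeasurable
    fun x => (h x).1).restrict _

lemma memLp_gradient_slaterE (n : ℕ) : MemLp (gradient (slaterE n)) 2 (chamberMeasure n) := by
  obtain ⟨C, k, -, h⟩ := exists_slaterE_bound n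
  exact (memLp_two_of_gaussian_bound volume
    (continuous_gradient (contDiff_slaterE n)).aestronglyMeasurable fun x => (h x).2).restrict _

lemma memLp_norm_mul_slaterE (n : ℕ) :
    MemLp (fun x => ‖x‖ * slaterE n x) 2 (chamberMeasure n) := by
  obtain ⟨C, k, hC, h⟩ := exists_slaterE_bound n
  refine (memLp_two_of_gaussian_bound volume
    (continuous_norm.mul (contDiff_slaterE n).continuous).aestronglyMeasurable
    (C := C) (k := k + 1) fun x => ?_).restrict _
  rw [Pi.mul_apply, norm_mul, norm_norm]
  calc ‖x‖ * ‖slaterE n x‖ ≤ (1 + ‖x‖) * (C * (1 + ‖x‖) ^ k * Real.exp (-‖x‖ ^ 2 / 2)) :=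
        mul_le_mul (by linarith) (h x).1 (norm_nonneg _) (by positivity)
    _ = _ := by ring

lemma slaterE_ne_zero {n : ℕ} {x : EuclideanSpace ℝ (Fin n)} (hx : x ∈ chamber n) :
    slaterE n x ≠ 0 := by
  refine slater_ne_zero_iff.2 (StrictMono.injective fun i j hij => hx i j hij)

/-- On the closure the coordinates are weakly increasing; outside the chamber two of them must
coincide, and the determinant has two equal columns. -/
lemma slaterE_eq_zero_of_mem_closure {n : ℕ} {x : EuclideanSpace ℝ (Fin n)}
    (hx : x ∈ closure (chamber n)) (hx' : x ∉ chamber n) : slaterE n x = 0 := by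
  have hle : ∀ i j : Fin n, i < j → x i ≤ x j := by
    have hcl : IsClosed {x : EuclideanSpace ℝ (Fin n) | ∀ i j : Fin n, i < j → x i ≤ x j} := by
      simp only [ofPred_forall]
      exact isClosed_iInter fun i => isClosed_iInter fun j => isClosed_iInter fun _ =>
        isClosed_le (by fun_prop) (by fun_prop)
    exact closure_minimal (fun y hy i j hij => (hy i j hij).le) hcl hx
  by_contra hne
  refine hx' fun i j hij => lt_of_le_of_ne (hle i j hij) fun h => ?_
  exact hij.ne (slater_ne_zero_iff.1 hne h)

/-! ### Approximation by test functions -/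

/-- A smooth function vanishing on `[-1, 1]` and equal to the identity outside `(-2, 2)`. -/
noncomputable def cutId (s : ℝ) : ℝ := s * Real.smoothTransition (s ^ 2 - 1)

lemma contDiff_cutId : ContDiff ℝ ∞ cutId := by
  unfold cutId
  exact contDiff_id.mul (Real.smoothTransition.contDiff.comp (by fun_prop))

lemma cutId_eq_zero {s : ℝ} (hs : |s| ≤ 1) : cutId s = 0 := by
  rw [cutId, Real.smoothTransition.zero_of_nonpos, mul_zero]
  have := (sq_le_one_iff_abs_le_one s).2 hs
  linarith

lemma cutId_eq_self {s : ℝ} (hs : 2 ≤ |s|) : cutId s = s := by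
  rw [cutId, Real.smoothTransition.one_of_one_le, mul_one]
  have := sq_abs s
  nlinarith

lemma abs_cutId_le (s : ℝ) : |cutId s| ≤ |s| := by
  rw [cutId, abs_mul, abs_of_nonneg (Real.smoothTransition.nonneg _)]
  exact mul_le_of_le_one_right (abs_nonneg _) (Real.smoothTransition.le_one _)

lemma deriv_cutId_eq_one {s : ℝ} (hs : 2 < |s|) : deriv cutId s = 1 := by
  have : cutId =ᶠ[𝓝 s] id := by
    filter_upwards [(isOpen_lt continuous_const continuous_abs).mem_nhds hs] with t ht
    exact cutId_eq_self ht.le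
  rw [this.deriv_eq, deriv_id]

lemma exists_abs_deriv_cutId_le : ∃ M : ℝ, ∀ s, |deriv cutId s| ≤ M := by
  have hc : Continuous (deriv cutId) := contDiff_cutId.continuous_deriv (by simp)
  obtain ⟨M, hM⟩ := (isCompact_Icc (a := (-2 : ℝ)) (b := 2)).exists_bound_of_continuousOn
    hc.continuousOn
  refine ⟨max M 1, fun s => ?_⟩
  rcases le_or_gt |s| 2 with hs | hs
  · exact (hM s (abs_le.1 hs)).trans (le_max_left _ _)
  · rw [deriv_cutId_eq_one hs, abs_one]; exact le_max_right _ _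

/-- Truncation of the Slater determinant near the boundary of the chamber and at infinity. -/
noncomputable def slaterCut (n : ℕ) (ε : ℝ) : EuclideanSpace ℝ (Fin n) → ℝ :=
  (chamber n).indicator fun x => ε * cutId (slaterE n x / ε)

variable {n : ℕ} {ε : ℝ}

lemma support_slaterCut_subset (hε : 0 < ε) :
    Function.support (slaterCut n ε) ⊆ {x ∈ closure (chamber n) | ε ≤ |slaterE n x|} := by
  intro x hx
  rw [slaterCut, Function.mem_support, Set.indicator_apply_ne_zero] at hx
  refine ⟨subset_closure hx.1, ?_⟩
  by_contra! h
  refine hx.2 ?_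
  change ε * cutId (slaterE n x / ε) = 0
  rw [cutId_eq_zero, mul_zero]
  rw [abs_div, abs_of_pos hε]
  exact (div_le_one hε).2 h.le

/-- The support lies where `|slaterE| ≥ ε`. This closed part of the closure misses the boundary,
where the determinant vanishes, and is bounded because the determinant decays. -/
lemma isTest_slaterCut (hε : 0 < ε) : IsTest n (slaterCut n ε) := by
  have hUc : Continuous (slaterE n) := (contDiff_slaterE n).continuous
  set K := {x ∈ closure (chamber n) | ε ≤ |slaterE n x|}
  have hK : IsClosed K := isClosed_closure.inter (isClosed_le continuous_const hUc.abs)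
  have hts : tsupport (slaterCut n ε) ⊆ K := closure_minimal (support_slaterCut_subset hε) hK
  have hKc : K ⊆ chamber n := by
    intro x hx
    by_contra h
    have := hx.2
    rw [slaterE_eq_zero_of_mem_closure hx.1 h, abs_zero] at this
    linarith
  have hsm : ContDiff ℝ ∞ fun x => ε * cutId (slaterE n x / ε) :=
    contDiff_const.mul (contDiff_cutId.comp ((contDiff_slaterE n).div_const ε))
  refine ⟨contDiff_iff_contDiffAt.2 fun x => ?_, ?_, hts.trans hKc⟩
  · by_cases hx : x ∈ chamber n
    · refine hsm.contDiffAt.congr_of_eventuallyEq ?_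
      filter_upwards [(isOpen_chamber n).mem_nhds hx] with y hy
      exact Set.indicator_of_mem hy _
    · have h0 := notMem_tsupport_iff_eventuallyEq.1 fun h => hx (hKc (hts h))
      exact contDiffAt_const.congr_of_eventuallyEq h0
  · obtain ⟨C, k, hC, hb⟩ := exists_slaterE_bound n
    set D := C * Real.exp (((k + 1 : ℕ) : ℝ) ^ 2 / 2)
    refine HasCompactSupport.of_support_subset_isCompact (isCompact_closedBall 0 (D / ε))
      fun x hx => ?_
    have h1 := (support_slaterCut_subset hε hx).2
    have h2 := (hb x).1.trans (gaussian_bound_decay hC k 1 (norm_nonneg x))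
    rw [mem_closedBall_zero_iff, le_div_iff₀ hε]
    have h3 : ε ≤ D * ((1 + ‖x‖) ^ 1)⁻¹ := h1.trans h2
    rw [pow_one, ← div_eq_mul_inv, le_div_iff₀ (by positivity)] at h3
    nlinarith [norm_nonneg x]

/-- The two factors `ε` cancel, so the gradient is multiplied by a factor bounded uniformly in `ε`.
Truncating by the values of the function thus needs no estimate on the distance to the boundary. -/
lemma gradient_slaterCut (hε : 0 < ε) {x : EuclideanSpace ℝ (Fin n)} (hx : x ∈ chamber n) :
    gradient (slaterCut n ε) x = deriv cutId (slaterE n x / ε) • gradient (slaterE n) x := by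
  have he : slaterCut n ε =ᶠ[𝓝 x] fun x => ε * cutId (slaterE n x / ε) := by
    filter_upwards [(isOpen_chamber n).mem_nhds hx] with y hy
    exact Set.indicator_of_mem hy _
  have h1 : HasFDerivAt (fun x => slaterE n x / ε) (ε⁻¹ • fderiv ℝ (slaterE n) x) x := by
    have := ((contDiff_slaterE n).differentiable (by simp) x).hasFDerivAt.const_mul ε⁻¹
    exact this.congr_of_eventuallyEq (Eventually.of_forall fun y => by simp [div_eq_inv_mul])
  have h2 : HasDerivAt cutId (deriv cutId (slaterE n x / ε)) (slaterE n x / ε) :=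
    (contDiff_cutId.differentiable (by simp) _).hasDerivAt
  have h3 := (h2.comp_hasFDerivAt x h1).const_mul ε
  have h4 : fderiv ℝ (slaterCut n ε) x
      = deriv cutId (slaterE n x / ε) • fderiv ℝ (slaterE n) x := by
    rw [he.fderiv_eq]
    refine (h3.congr_fderiv ?_).fderiv
    rw [smul_smul, smul_smul]
    congr 1
    field_simp
  rw [gradient, h4, gradient, map_smulₛₗ]
  simp

lemma tendsto_eLpNorm_two_of_dominated {α F : Type*} [MeasurableSpace α] {μ : Measure α}
    [NormedAddCommGroup F] {f : ℕ → α → F} {g : α → ℝ} (hf : ∀ k, AEStronglyMeasurable (f k) μ)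
    (hg : MemLp g 2 μ) (hb : ∀ k, ∀ᵐ x ∂μ, ‖f k x‖ ≤ g x)
    (hlim : ∀ᵐ x ∂μ, Tendsto (fun k => f k x) atTop (𝓝 0)) :
    Tendsto (fun k => eLpNorm (f k) 2 μ) atTop (𝓝 0) := by
  have hm (k : ℕ) : MemLp (f k) 2 μ := hg.of_le (hf k) <| by
    filter_upwards [hb k] with x hx
    exact hx.trans (le_abs_self _)
  have h1 : Tendsto (fun k => ∫ x, ‖f k x‖ ^ 2 ∂μ) atTop (𝓝 (∫ _, (0 : ℝ) ∂μ)) := by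
    refine tendsto_integral_of_dominated_convergence (fun x => g x ^ 2)
      (fun k => (hf k).norm.pow 2) hg.integrable_sq (fun k => ?_) ?_
    · filter_upwards [hb k] with x hx
      rw [Real.norm_of_nonneg (by positivity)]
      exact pow_le_pow_left₀ (norm_nonneg _) hx 2
    · filter_upwards [hlim] with x hx
      simpa using (hx.norm.pow 2)
  have h2 (k : ℕ) : eLpNorm (f k) 2 μ = ENNReal.ofReal ((∫ x, ‖f k x‖ ^ 2 ∂μ) ^ (2 : ℝ)⁻¹) := by
    rw [(hm k).eLpNorm_eq_integral_rpow_norm (by simp) (by simp)]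
    simp
  simp only [h2]
  have h3 := (ENNReal.continuous_ofReal.tendsto _).comp
    (h1.rpow_const (p := (2 : ℝ)⁻¹) (Or.inr (by norm_num)))
  simpa [Function.comp_def] using h3

lemma inFormDomain_slaterE (n : ℕ) : InFormDomain n (slaterE n) (gradient (slaterE n)) := by
  refine ⟨memLp_slaterE n, memLp_gradient_slaterE n, memLp_norm_mul_slaterE n, ?_⟩
  have hpos (k : ℕ) : (0 : ℝ) < 1 / ((k : ℝ) + 1) := by positivity
  set φ : ℕ → EuclideanSpace ℝ (Fin n) → ℝ := fun k => slaterCut n (1 / ((k : ℝ) + 1)) with hφ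
  have hT (k : ℕ) : IsTest n (φ k) := isTest_slaterCut (hpos k)
  obtain ⟨M, hM⟩ := exists_abs_deriv_cutId_le
  have hUc : Continuous (slaterE n) := (contDiff_slaterE n).continuous
  have hGc := continuous_gradient (contDiff_slaterE n)
  -- At a fixed point of the chamber the determinant is nonzero, so for large `k` the truncation is
  -- inactive: value and gradient agree with the original there, and dominated convergence applies.
  have hev {x : EuclideanSpace ℝ (Fin n)} (hx : x ∈ chamber n) :
      ∀ᶠ k : ℕ in atTop, 2 < |slaterE n x / (1 / ((k : ℝ) + 1))| := by
    have h1 := tendsto_one_div_add_atTop_nhds_zero_nat (𝕜 := ℝ)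
    filter_upwards [h1.eventually_lt_const (half_pos (abs_pos.2 (slaterE_ne_zero hx)))] with k hk
    rw [abs_div, abs_of_pos (hpos k), lt_div_iff₀ (hpos k)]
    linarith
  have hae : ∀ᵐ x ∂(chamberMeasure n), x ∈ chamber n := ae_restrict_mem (measurableSet_chamber n)
  have hval (k : ℕ) {x : EuclideanSpace ℝ (Fin n)} (hx : x ∈ chamber n) :
      φ k x = 1 / ((k : ℝ) + 1) * cutId (slaterE n x / (1 / ((k : ℝ) + 1))) :=
    Set.indicator_of_mem hx _
  have hbd (k : ℕ) {x : EuclideanSpace ℝ (Fin n)} (hx : x ∈ chamber n) :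
      |φ k x - slaterE n x| ≤ 2 * |slaterE n x| := by
    have : |φ k x| ≤ |slaterE n x| := by
      rw [hval k hx, abs_mul, abs_of_pos (hpos k)]
      refine (mul_le_mul_of_nonneg_left (abs_cutId_le _) (hpos k).le).trans_eq ?_
      rw [abs_div, abs_of_pos (hpos k)]
      field_simp
    linarith [abs_sub (φ k x) (slaterE n x)]
  have hlim {x : EuclideanSpace ℝ (Fin n)} (hx : x ∈ chamber n) :
      ∀ᶠ k : ℕ in atTop, φ k x - slaterE n x = 0 := by
    filter_upwards [hev hx] with k hk
    rw [hval k hx, cutId_eq_self hk.le, sub_eq_zero]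
    have := hpos k
    field_simp
  refine ⟨φ, hT, ?_, ?_, ?_⟩
  · refine tendsto_eLpNorm_two_of_dominated (g := fun x => 2 * |slaterE n x|)
      (fun k => ((hT k).smooth.continuous.sub hUc).aestronglyMeasurable)
      ((memLp_slaterE n).norm.const_mul 2) (fun k => ?_) ?_
    · filter_upwards [hae] with x hx using hbd k hx
    · filter_upwards [hae] with x hx using tendsto_const_nhds.congr' ((hlim hx).mono fun _ h => h.symm)
  · refine tendsto_eLpNorm_two_of_dominated (g := fun x => (M + 1) * ‖gradient (slaterE n) x‖)
      (fun k => ((continuous_gradient (hT k).smooth).sub hGc).aestronglyMeasurable)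
      ((memLp_gradient_slaterE n).norm.const_mul _) (fun k => ?_) ?_
    · filter_upwards [hae] with x hx
      rw [hφ, gradient_slaterCut (hpos k) hx]
      refine (norm_sub_le _ _).trans ?_
      rw [norm_smul, add_mul, one_mul]
      gcongr
      exact hM _
    · filter_upwards [hae] with x hx
      refine tendsto_const_nhds.congr' ?_
      filter_upwards [hev hx] with k hk
      rw [hφ, gradient_slaterCut (hpos k) hx, deriv_cutId_eq_one hk, one_smul, sub_self]
  · refine tendsto_eLpNorm_two_of_dominated (g := fun x => 2 * ‖‖x‖ * slaterE n x‖)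
      (fun k => (continuous_norm.mul
        ((hT k).smooth.continuous.sub hUc)).aestronglyMeasurable)
      ((memLp_norm_mul_slaterE n).norm.const_mul 2) (fun k => ?_) ?_
    · filter_upwards [hae] with x hx
      rw [norm_mul, norm_mul, norm_norm, mul_left_comm]
      exact mul_le_mul_of_nonneg_left (hbd k hx) (norm_nonneg x)
    · filter_upwards [hae] with x hx
      exact tendsto_const_nhds.congr' ((hlim hx).mono fun _ h => by simp only [h, mul_zero])

end Approximation

/-! ### The ground state representation of the form -/

section GroundState

variable {n : ℕ} {φ : EuclideanSpace ℝ (Fin n) → ℝ}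

lemma IsTest.mul {ψ : EuclideanSpace ℝ (Fin n) → ℝ} (h : IsTest n φ) (hψ : ContDiff ℝ ∞ ψ) :
    IsTest n (fun x => φ x * ψ x) :=
  ⟨h.smooth.mul hψ, h.compact.mul_right, (tsupport_mul_subset_left).trans h.support⟩

/-- The quotient is smooth in the chamber, where the denominator has no zero, and vanishes near
every point outside it because its support stays inside that of `φ`. -/
lemma IsTest.div_slaterE (h : IsTest n φ) : IsTest n (fun x => φ x / slaterE n x) := by
  have hs : tsupport (fun x => φ x / slaterE n x) ⊆ tsupport φ := by
    refine closure_mono fun x hx hx' => hx ?_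
    change φ x / slaterE n x = 0
    rw [hx', zero_div]
  refine ⟨contDiff_iff_contDiffAt.2 fun x => ?_, h.compact.mono' (subset_closure.trans hs),
    hs.trans h.support⟩
  by_cases hx : x ∈ chamber n
  · exact h.smooth.contDiffAt.div (contDiff_slaterE n).contDiffAt (slaterE_ne_zero hx)
  · have h0 := notMem_tsupport_iff_eventuallyEq.1 fun h' => hx (h.support (hs h'))
    exact contDiffAt_const.congr_of_eventuallyEq h0

lemma gradient_mul {f g : EuclideanSpace ℝ (Fin n) → ℝ} {x : EuclideanSpace ℝ (Fin n)}
    (hf : DifferentiableAt ℝ f x) (hg : DifferentiableAt ℝ g x) :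
    gradient (fun x => f x * g x) x = f x • gradient g x + g x • gradient f x := by
  simp [gradient, fderiv_fun_mul hf hg]

lemma IsTest.memLp (h : IsTest n φ) : MemLp φ 2 (chamberMeasure n) :=
  (h.smooth.continuous.memLp_of_hasCompactSupport h.compact).restrict _

lemma IsTest.memLp_gradient (h : IsTest n φ) : MemLp (gradient φ) 2 (chamberMeasure n) :=
  ((continuous_gradient h.smooth).memLp_of_hasCompactSupport h.hasCompactSupport_gradient).restrict _

lemma IsTest.memLp_weight (h : IsTest n φ) : MemLp (fun x => ‖x‖ * φ x) 2 (chamberMeasure n) :=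
  ((continuous_norm.mul h.smooth.continuous).memLp_of_hasCompactSupport
    h.compact.mul_left).restrict _

lemma IsTest.integrable_form (h : IsTest n φ) : Integrable
    (fun x => ‖gradient φ x‖ ^ 2 + ‖x‖ ^ 2 * φ x ^ 2) (chamberMeasure n) := by
  refine h.memLp_gradient.norm.integrable_sq.add ?_
  refine h.memLp_weight.integrable_sq.congr (Eventually.of_forall fun x => ?_)
  simp [mul_pow]

lemma IsTest.memLp_slaterE_smul_gradient (h : IsTest n φ) :
    MemLp (fun x => slaterE n x • gradient φ x) 2 (chamberMeasure n) :=
  (((contDiff_slaterE n).continuous.smul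
    (continuous_gradient h.smooth)).memLp_of_hasCompactSupport
    h.hasCompactSupport_gradient.smul_left).restrict _

lemma ground_state_representation (h : IsTest n φ) :
    ∫ x, (‖gradient φ x‖ ^ 2 + ‖x‖ ^ 2 * φ x ^ 2) ∂(chamberMeasure n)
      = slaterEigenvalue n * ∫ x, φ x ^ 2 ∂(chamberMeasure n) +
        ∫ x, ‖slaterE n x • gradient (fun y => φ y / slaterE n y) x‖ ^ 2 ∂(chamberMeasure n) := by
  have hw := h.div_slaterE
  set w := fun y => φ y / slaterE n y with hwdef
  -- The weak equation is tested with `φ w = U w²`; pointwise `|∇(U w)|² - U² |∇w|² = ∇U · ∇(U w²)`.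
  have hψ := h.mul hw.smooth
  have hU := contDiff_slaterE n
  have hUd : Differentiable ℝ (slaterE n) := hU.differentiable (by simp)
  have hφw {x : EuclideanSpace ℝ (Fin n)} (hx : x ∈ chamber n) : φ x = slaterE n x * w x := by
    rw [hwdef]; field_simp [slaterE_ne_zero hx]
  have hgrad {x : EuclideanSpace ℝ (Fin n)} (hx : x ∈ chamber n) :
      gradient φ x = slaterE n x • gradient w x + w x • gradient (slaterE n) x := by
    have he : φ =ᶠ[𝓝 x] fun x => slaterE n x * w x := by
      filter_upwards [(isOpen_chamber n).mem_nhds hx] with y hy using hφw hy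
    rw [he.gradient_eq, gradient_mul (hUd x) (hw.smooth.differentiable (by simp) x)]
  have hae : ∀ᵐ x ∂(chamberMeasure n), x ∈ chamber n := ae_restrict_mem (measurableSet_chamber n)
  have e1 : ∫ x, φ x ^ 2 ∂(chamberMeasure n)
      = ∫ x, slaterE n x * (φ x * w x) ∂(chamberMeasure n) := by
    refine integral_congr_ae ?_
    filter_upwards [hae] with x hx
    rw [hφw hx]; ring
  have i1 : Integrable (fun x => ‖slaterE n x • gradient w x‖ ^ 2) (chamberMeasure n) :=
    hw.memLp_slaterE_smul_gradient.norm.integrable_sq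
  rw [e1, ← weak_equation_slaterE hψ, ← sub_eq_iff_eq_add, ← integral_sub h.integrable_form i1]
  refine integral_congr_ae ?_
  filter_upwards [hae] with x hx
  rw [gradient_mul (h.smooth.differentiable (by simp) x) (hw.smooth.differentiable (by simp) x),
    hgrad hx, hφw hx, norm_smul, mul_pow, norm_add_sq_real, norm_smul, norm_smul]
  simp only [inner_add_right, inner_smul_right, inner_smul_left, Real.norm_eq_abs, mul_pow, sq_abs,
    conj_trivial, real_inner_self_eq_norm_sq, real_inner_comm (gradient w x)]
  ring

/-! ### Passing to the limit in the form -/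

lemma integrable_inner_of_memLp {α F : Type*} [MeasurableSpace α] {μ : Measure α}
    [NormedAddCommGroup F] [InnerProductSpace ℝ F] {f g : α → F} (hf : MemLp f 2 μ)
    (hg : MemLp g 2 μ) : Integrable (fun x => inner ℝ (f x) (g x)) μ := by
  refine (hf.norm.integrable_mul hg.norm).mono'
    (hf.aestronglyMeasurable.inner hg.aestronglyMeasurable) (Eventually.of_forall fun x => ?_)
  exact norm_inner_le_norm (𝕜 := ℝ) (f x) (g x)

lemma tendsto_integral_inner {α F : Type*} [MeasurableSpace α] {μ : Measure α}
    [NormedAddCommGroup F] [InnerProductSpace ℝ F] {f g : ℕ → α → F} {f₀ g₀ : α → F}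
    (hf : ∀ k, MemLp (f k) 2 μ) (hg : ∀ k, MemLp (g k) 2 μ) (hf₀ : MemLp f₀ 2 μ)
    (hg₀ : MemLp g₀ 2 μ) (hft : Tendsto (fun k => eLpNorm (fun x => f k x - f₀ x) 2 μ) atTop (𝓝 0))
    (hgt : Tendsto (fun k => eLpNorm (fun x => g k x - g₀ x) 2 μ) atTop (𝓝 0)) :
    Tendsto (fun k => ∫ x, inner ℝ (f k x) (g k x) ∂μ) atTop (𝓝 (∫ x, inner ℝ (f₀ x) (g₀ x) ∂μ)) := by
  have h1 := (Lp.tendsto_Lp_iff_tendsto_eLpNorm'' f hf f₀ hf₀).2 hft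
  have h2 := (Lp.tendsto_Lp_iff_tendsto_eLpNorm'' g hg g₀ hg₀).2 hgt
  have key {a b : α → F} (ha : MemLp a 2 μ) (hb : MemLp b 2 μ) :
      inner ℝ (ha.toLp a) (hb.toLp b) = ∫ x, inner ℝ (a x) (b x) ∂μ := by
    rw [L2.inner_def]
    refine integral_congr_ae ?_
    filter_upwards [ha.coeFn_toLp, hb.coeFn_toLp] with x h1 h2
    rw [h1, h2]
  have h3 := h1.inner (𝕜 := ℝ) h2
  simpa only [key] using h3

lemma tendsto_integral_sq_norm {α F : Type*} [MeasurableSpace α] {μ : Measure α}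
    [NormedAddCommGroup F] [InnerProductSpace ℝ F] {f : ℕ → α → F} {f₀ : α → F}
    (hf : ∀ k, MemLp (f k) 2 μ) (hf₀ : MemLp f₀ 2 μ)
    (hft : Tendsto (fun k => eLpNorm (fun x => f k x - f₀ x) 2 μ) atTop (𝓝 0)) :
    Tendsto (fun k => ∫ x, ‖f k x‖ ^ 2 ∂μ) atTop (𝓝 (∫ x, ‖f₀ x‖ ^ 2 ∂μ)) := by
  simpa only [real_inner_self_eq_norm_sq] using tendsto_integral_inner hf hf hf₀ hf₀ hft hft

lemma tendsto_integral_inner_const {α F : Type*} [MeasurableSpace α] {μ : Measure α}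
    [NormedAddCommGroup F] [InnerProductSpace ℝ F] {f : ℕ → α → F} {f₀ : α → F}
    (hf : ∀ k, MemLp (f k) 2 μ) (hf₀ : MemLp f₀ 2 μ)
    (hft : Tendsto (fun k => eLpNorm (fun x => f k x - f₀ x) 2 μ) atTop (𝓝 0)) :
    Tendsto (fun k => ∫ x, inner ℝ (f₀ x) (f k x) ∂μ) atTop (𝓝 (∫ x, ‖f₀ x‖ ^ 2 ∂μ)) := by
  simpa only [real_inner_self_eq_norm_sq] using
    tendsto_integral_inner (fun _ => hf₀) hf hf₀ hf₀ (by simp) hft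

/-- Evaluates the limit of the ground state remainder `∫ U² |∇w_k|²`, from which both minimality and
simplicity of the eigenvalue are read off. -/
lemma IsDirichletEigenfunction.exists_approx {μ : ℝ} {v : EuclideanSpace ℝ (Fin n) → ℝ}
    (hv : IsDirichletEigenfunction n μ v) : MemLp v 2 (chamberMeasure n) ∧
    ∃ φ : ℕ → EuclideanSpace ℝ (Fin n) → ℝ, (∀ k, IsTest n (φ k)) ∧
      Tendsto (fun k => eLpNorm (fun x => φ k x - v x) 2 (chamberMeasure n)) atTop (𝓝 0) ∧
      Tendsto (fun k => ∫ x, ‖slaterE n x • gradient (fun y => φ k y / slaterE n y) x‖ ^ 2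
        ∂(chamberMeasure n)) atTop
        (𝓝 ((μ - slaterEigenvalue n) * ∫ x, v x ^ 2 ∂(chamberMeasure n))) := by
  obtain ⟨-, G, ⟨hL, hLG, hLw, φ, hφ, t1, t2, t3⟩, heq⟩ := hv
  refine ⟨hL, φ, hφ, t1, ?_⟩
  have t3' : Tendsto (fun k => eLpNorm (fun x => ‖x‖ * φ k x - ‖x‖ * v x) 2 (chamberMeasure n))
      atTop (𝓝 0) := by
    simpa only [mul_sub] using t3
  have a1 := tendsto_integral_sq_norm (fun k => (hφ k).memLp) hL t1
  have a2 := tendsto_integral_sq_norm (fun k => (hφ k).memLp_gradient) hLG t2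
  have a3 := tendsto_integral_sq_norm (fun k => (hφ k).memLp_weight) hLw t3'
  have b1 := tendsto_integral_inner_const (fun k => (hφ k).memLp) hL t1
  have b2 := tendsto_integral_inner_const (fun k => (hφ k).memLp_gradient) hLG t2
  have b3 := tendsto_integral_inner_const (fun k => (hφ k).memLp_weight) hLw t3'
  simp only [norm_mul, Real.norm_eq_abs, mul_pow, sq_abs] at a1 a3 b1 b3
  -- The eigenvalue equation is only given against test functions; putting `φ k` in it and letting
  -- `k → ∞` amounts to testing with `v` itself.
  have hlim : ∫ x, ‖G x‖ ^ 2 ∂(chamberMeasure n) + ∫ x, ‖x‖ ^ 2 * v x ^ 2 ∂(chamberMeasure n)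
      = μ * ∫ x, v x ^ 2 ∂(chamberMeasure n) := by
    refine tendsto_nhds_unique (b2.add b3) ((b1.const_mul μ).congr fun k => ?_)
    have := heq (φ k) (hφ k)
    rw [← integral_add]
    · simp only [RCLike.inner_apply, conj_trivial]
      simp only [mul_comm (φ k _)] at this ⊢
      rw [← this]
      exact integral_congr_ae (Eventually.of_forall fun x => by simp only; ring)
    · exact integrable_inner_of_memLp hLG (hφ k).memLp_gradient
    · exact integrable_inner_of_memLp hLw (hφ k).memLp_weight
  have hform (k : ℕ) : ∫ x, ‖slaterE n x • gradient (fun y => φ k y / slaterE n y) x‖ ^ 2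
      ∂(chamberMeasure n) = (∫ x, ‖gradient (φ k) x‖ ^ 2 ∂(chamberMeasure n) +
        ∫ x, ‖x‖ ^ 2 * φ k x ^ 2 ∂(chamberMeasure n)) -
        slaterEigenvalue n * ∫ x, φ k x ^ 2 ∂(chamberMeasure n) := by
    have := ground_state_representation (hφ k)
    rw [integral_add (hφ k).memLp_gradient.norm.integrable_sq
      ((hφ k).memLp_weight.integrable_sq.congr (Eventually.of_forall fun x => by simp [mul_pow]))]
      at this
    linarith
  simp only [hform]
  have := (a2.add a3).sub (a1.const_mul (slaterEigenvalue n))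
  rwa [hlim, ← sub_mul] at this

lemma IsDirichletEigenfunction.slaterEigenvalue_le {μ : ℝ} {v : EuclideanSpace ℝ (Fin n) → ℝ}
    (hv : IsDirichletEigenfunction n μ v) : slaterEigenvalue n ≤ μ := by
  obtain ⟨hL, φ, -, -, hlim⟩ := hv.exists_approx
  have h0 : 0 ≤ (μ - slaterEigenvalue n) * ∫ x, v x ^ 2 ∂(chamberMeasure n) :=
    ge_of_tendsto' hlim fun k => integral_nonneg fun x => by positivity
  have hpos : 0 < ∫ x, v x ^ 2 ∂(chamberMeasure n) := by
    refine lt_of_le_of_ne (integral_nonneg fun x => sq_nonneg _) fun h => hv.1 ?_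
    have := (integral_eq_zero_iff_of_nonneg (fun x => sq_nonneg (v x)) hL.integrable_sq).1 h.symm
    filter_upwards [this] with x hx
    simpa using hx
  linarith [nonneg_of_mul_nonneg_left h0 hpos]

end GroundState

/-! ### A Poincaré inequality on convex sets -/

section Poincare

open ENNReal

variable {E : Type*} [NormedAddCommGroup E] [NormedSpace ℝ E]

lemma enorm_sub_le_lintegral_fderiv {g : E → ℝ} (hg : ContDiff ℝ 1 g) (x y : E) :
    ‖g x - g y‖ₑ ≤ ∫⁻ t in Ioc (0 : ℝ) 1, ‖fderiv ℝ g (y + t • (x - y))‖ₑ * ‖x - y‖ₑ := by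
  have hd (t : ℝ) : HasDerivAt (fun t : ℝ => g (y + t • (x - y)))
      (fderiv ℝ g (y + t • (x - y)) (x - y)) t := by
    have h1 : HasDerivAt (fun t : ℝ => y + t • (x - y)) (x - y) t := by
      simpa using ((hasDerivAt_id t).smul_const (x - y)).const_add y
    exact (hg.differentiable (by simp) _).hasFDerivAt.comp_hasDerivAt t h1
  have hc : Continuous fun t : ℝ => fderiv ℝ g (y + t • (x - y)) (x - y) :=
    ((hg.continuous_fderiv (by simp)).comp (by fun_prop)).clm_apply continuous_const
  have h := intervalIntegral.integral_eq_sub_of_hasDerivAt (a := 0) (b := 1)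
    (fun t _ => hd t) (hc.intervalIntegrable _ _)
  have h' : g x - g y = ∫ t in Ioc (0 : ℝ) 1, fderiv ℝ g (y + t • (x - y)) (x - y) := by
    rw [← intervalIntegral.integral_of_le zero_le_one, h]; simp
  rw [h']
  refine (enorm_integral_le_lintegral_enorm _).trans (lintegral_mono fun t => ?_)
  exact ContinuousLinearMap.le_opENorm _ _

variable [FiniteDimensional ℝ E] [MeasurableSpace E] [BorelSpace E]

/-- The Jacobian of the change of variables is `s` to the minus dimension, at most `2` to the
dimension since `s ≥ 1 / 2`. -/
lemma lintegral_comp_smul_add_le (μ : Measure E) [μ.IsAddHaarMeasure] {f : E → ℝ≥0∞}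
    (hf : Measurable f) {s : ℝ} (hs : 1 / 2 ≤ s) (z : E) :
    ∫⁻ x, f (s • x + z) ∂μ ≤ 2 ^ Module.finrank ℝ E * ∫⁻ x, f x ∂μ := by
  have hs0 : 0 < s := by linarith
  have h1 : ∫⁻ x, f (s • x + z) ∂μ = ∫⁻ x, f (x + z) ∂(Measure.map (s • ·) μ) :=
    (lintegral_map (hf.comp (measurable_add_const z)) (measurable_const_smul s)).symm
  rw [h1, Measure.map_addHaar_smul μ hs0.ne', lintegral_smul_measure,
    lintegral_add_right_eq_self, smul_eq_mul]
  gcongr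
  rw [abs_of_pos (by positivity), ENNReal.ofReal_le_iff_le_toReal (by finiteness)]
  rw [ENNReal.toReal_pow, ENNReal.toReal_ofNat, ← inv_pow]
  refine pow_le_pow_left₀ (by positivity) ?_ _
  rw [inv_le_comm₀ hs0 two_pos]
  linarith

/-- The point `t x + (1 - t) y` is integrated first in whichever variable has coefficient at least
`1 / 2`, so the Jacobian stays bounded uniformly in `t`; convexity keeps the point in `K`. -/
lemma lintegral_prod_segment_le (μ : Measure E) [μ.IsAddHaarMeasure] {K : Set E}
    (hK : MeasurableSet K) (hKc : Convex ℝ K) {f : E → ℝ≥0∞} (hf : Measurable f)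
    {t : ℝ} (ht : t ∈ Ioc (0 : ℝ) 1) :
    ∫⁻ p, f (p.2 + t • (p.1 - p.2)) ∂((μ.restrict K).prod (μ.restrict K))
      ≤ 2 ^ Module.finrank ℝ E * (∫⁻ x in K, f x ∂μ) * μ K := by
  have hfK : Measurable (K.indicator f) := hf.indicator hK
  have hm : Measurable fun p : E × E => f (p.2 + t • (p.1 - p.2)) :=
    hf.comp (by fun_prop)
  have hmem {x y : E} (hx : x ∈ K) (hy : y ∈ K) : y + t • (x - y) ∈ K :=
    hKc.add_smul_sub_mem hy hx ⟨ht.1.le, ht.2⟩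
  have hone (s : ℝ) (hs : 1 / 2 ≤ s) (z : E) (hz : ∀ x ∈ K, s • x + z ∈ K) :
      ∫⁻ x in K, f (s • x + z) ∂μ ≤ 2 ^ Module.finrank ℝ E * ∫⁻ x in K, f x ∂μ := by
    calc ∫⁻ x in K, f (s • x + z) ∂μ = ∫⁻ x in K, K.indicator f (s • x + z) ∂μ :=
          setLIntegral_congr_fun hK fun x hx => (Set.indicator_of_mem (hz x hx) f).symm
      _ ≤ ∫⁻ x, K.indicator f (s • x + z) ∂μ := setLIntegral_le_lintegral _ _
      _ ≤ _ := lintegral_comp_smul_add_le μ hfK hs z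
      _ = _ := by rw [lintegral_indicator hK]
  have hconst (A : ℝ≥0∞) : ∫⁻ _ in K, A ∂μ = A * μ K := by simp
  rw [← hconst]
  rcases le_total (1 / 2) t with h | h
  · rw [lintegral_prod_symm' _ hm]
    refine setLIntegral_mono' hK fun y hy => ?_
    have e (x : E) : y + t • (x - y) = t • x + (1 - t) • y := by module
    simp only [e]
    exact hone t h _ fun x hx => e x ▸ hmem hx hy
  · rw [lintegral_prod _ hm.aemeasurable]
    refine setLIntegral_mono' hK fun x hx => ?_
    have e (y : E) : y + t • (x - y) = (1 - t) • y + t • x := by module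
    simp only [e]
    exact hone (1 - t) (by linarith) _ fun y hy => e y ▸ hmem hx hy

lemma lintegral_enorm_sub_le (μ : Measure E) [μ.IsAddHaarMeasure] {K : Set E}
    (hK : MeasurableSet K) (hKc : Convex ℝ K) {D : ℝ≥0∞} (hD : ∀ x ∈ K, ∀ y ∈ K, ‖x - y‖ₑ ≤ D)
    {g : E → ℝ} (hg : ContDiff ℝ 1 g) :
    ∫⁻ p, ‖g p.1 - g p.2‖ₑ ∂((μ.restrict K).prod (μ.restrict K))
      ≤ 2 ^ Module.finrank ℝ E * (∫⁻ x in K, ‖fderiv ℝ g x‖ₑ ∂μ) * μ K * D := by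
  have hf : Continuous fun x => fderiv ℝ g x := hg.continuous_fderiv (by simp)
  have hfm : Measurable fun x => ‖fderiv ℝ g x‖ₑ := hf.enorm.measurable
  have hm : Measurable fun q : (E × E) × ℝ => ‖fderiv ℝ g (q.1.2 + q.2 • (q.1.1 - q.1.2))‖ₑ :=
    hfm.comp (by fun_prop)
  have hae : ∀ᵐ p ∂((μ.restrict K).prod (μ.restrict K)), p ∈ K ×ˢ K := by
    rw [Measure.prod_restrict]; exact ae_restrict_mem (hK.prod hK)
  calc ∫⁻ p, ‖g p.1 - g p.2‖ₑ ∂((μ.restrict K).prod (μ.restrict K))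
      ≤ ∫⁻ p, (∫⁻ t in Ioc (0 : ℝ) 1, ‖fderiv ℝ g (p.2 + t • (p.1 - p.2))‖ₑ) * D
          ∂((μ.restrict K).prod (μ.restrict K)) := by
        refine lintegral_mono_ae ?_
        filter_upwards [hae] with p hp
        refine (enorm_sub_le_lintegral_fderiv hg p.1 p.2).trans ?_
        have hmt : Measurable fun t : ℝ => ‖fderiv ℝ g (p.2 + t • (p.1 - p.2))‖ₑ :=
          hfm.comp (by fun_prop)
        rw [← lintegral_mul_const _ hmt]
        gcongr
        exact hD _ hp.1 _ hp.2
    _ = (∫⁻ t in Ioc (0 : ℝ) 1, ∫⁻ p, ‖fderiv ℝ g (p.2 + t • (p.1 - p.2))‖ₑ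
          ∂((μ.restrict K).prod (μ.restrict K))) * D := by
        rw [lintegral_mul_const _ hm.lintegral_prod_right',
          lintegral_lintegral_swap hm.aemeasurable]
    _ ≤ (∫⁻ _ in Ioc (0 : ℝ) 1,
          2 ^ Module.finrank ℝ E * (∫⁻ x in K, ‖fderiv ℝ g x‖ₑ ∂μ) * μ K) * D := by
        refine mul_le_mul' (setLIntegral_mono' measurableSet_Ioc fun t ht => ?_) le_rfl
        exact lintegral_prod_segment_le μ hK hKc hfm ht
    _ = _ := by simp

/-- An `L¹` limit of `C¹` functions whose derivatives tend to zero in `L¹` of a bounded convex set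
is almost everywhere constant there. -/
lemma ae_eq_of_tendsto_of_tendsto_fderiv (μ : Measure E) [μ.IsAddHaarMeasure] {K : Set E}
    (hK : MeasurableSet K) (hKc : Convex ℝ K) (hKb : Bornology.IsBounded K) {g : ℕ → E → ℝ}
    (hg : ∀ k, ContDiff ℝ 1 (g k)) {w : E → ℝ} (hw : AEStronglyMeasurable w (μ.restrict K))
    (h1 : Tendsto (fun k => ∫⁻ x in K, ‖g k x - w x‖ₑ ∂μ) atTop (𝓝 0))
    (h2 : Tendsto (fun k => ∫⁻ x in K, ‖fderiv ℝ (g k) x‖ₑ ∂μ) atTop (𝓝 0)) :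
    ∀ᵐ p ∂((μ.restrict K).prod (μ.restrict K)), w p.1 = w p.2 := by
  set ν := μ.restrict K
  have hfin : μ K < ⊤ := hKb.measure_lt_top
  have : IsFiniteMeasure ν := ⟨by simpa [ν] using hfin⟩
  have hνK : ν univ = μ K := by simp [ν]
  have hD : ∀ x ∈ K, ∀ y ∈ K, ‖x - y‖ₑ ≤ Metric.ediam K := fun x hx y hy => by
    rw [← edist_eq_enorm_sub]; exact Metric.edist_le_ediam_of_mem hx hy
  have hDfin : Metric.ediam K ≠ ⊤ := hKb.ediam_ne_top
  have hgm (k : ℕ) : AEStronglyMeasurable (g k) ν := (hg k).continuous.aestronglyMeasurable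
  have hm (k : ℕ) : AEMeasurable (fun x => ‖g k x - w x‖ₑ) ν := ((hgm k).sub hw).enorm
  have hfst (k : ℕ) : ∫⁻ p, ‖g k p.1 - w p.1‖ₑ ∂(ν.prod ν) = (∫⁻ x, ‖g k x - w x‖ₑ ∂ν) * μ K := by
    rw [lintegral_prod _ (hm k).comp_fst]
    simp only [lintegral_const, hνK]
    rw [lintegral_mul_const' _ _ hfin.ne]
  have hsnd (k : ℕ) : ∫⁻ p, ‖g k p.2 - w p.2‖ₑ ∂(ν.prod ν) = (∫⁻ x, ‖g k x - w x‖ₑ ∂ν) * μ K := by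
    rw [lintegral_prod _ (hm k).comp_snd]
    simp only [lintegral_const, hνK]
  have hle (k : ℕ) : ∫⁻ p, ‖w p.1 - w p.2‖ₑ ∂(ν.prod ν) ≤
      (∫⁻ x, ‖g k x - w x‖ₑ ∂ν) * μ K + 2 ^ Module.finrank ℝ E *
        (∫⁻ x in K, ‖fderiv ℝ (g k) x‖ₑ ∂μ) * μ K * Metric.ediam K
        + (∫⁻ x, ‖g k x - w x‖ₑ ∂ν) * μ K := by
    -- Comparing `w` with `g k` at both points leaves two `L¹` errors and a difference of `g k`,
    -- which the Poincaré bound controls by the derivative.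
    have htri (p : E × E) : ‖w p.1 - w p.2‖ₑ ≤
        ‖g k p.1 - w p.1‖ₑ + ‖g k p.1 - g k p.2‖ₑ + ‖g k p.2 - w p.2‖ₑ := by
      have e : w p.1 - w p.2 = -(g k p.1 - w p.1) + (g k p.1 - g k p.2) + (g k p.2 - w p.2) := by
        ring
      rw [e]
      refine (enorm_add_le _ _).trans (add_le_add_left ((enorm_add_le _ _).trans ?_) _)
      rw [enorm_neg]
    refine (lintegral_mono htri).trans ?_
    rw [lintegral_add_right' _ (hm k).comp_snd, lintegral_add_left' (hm k).comp_fst, hfst, hsnd]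
    gcongr
    exact lintegral_enorm_sub_le μ hK hKc hD (hg k)
  have hlim : Tendsto (fun k => (∫⁻ x, ‖g k x - w x‖ₑ ∂ν) * μ K + 2 ^ Module.finrank ℝ E *
        (∫⁻ x in K, ‖fderiv ℝ (g k) x‖ₑ ∂μ) * μ K * Metric.ediam K
        + (∫⁻ x, ‖g k x - w x‖ₑ ∂ν) * μ K) atTop (𝓝 0) := by
    have a1 : Tendsto (fun k => (∫⁻ x, ‖g k x - w x‖ₑ ∂ν) * μ K) atTop (𝓝 (0 * μ K)) :=
      ENNReal.Tendsto.mul_const h1 (Or.inr hfin.ne)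
    have a2 := ENNReal.Tendsto.mul_const (ENNReal.Tendsto.mul_const (ENNReal.Tendsto.const_mul
      (a := 2 ^ Module.finrank ℝ E) h2 (Or.inr (by finiteness))) (b := μ K) (Or.inr hfin.ne))
      (b := Metric.ediam K) (Or.inr hDfin)
    simpa using (a1.add a2).add a1
  have hzero : ∫⁻ p, ‖w p.1 - w p.2‖ₑ ∂(ν.prod ν) = 0 :=
    le_antisymm (ge_of_tendsto' hlim hle) (zero_le)
  have hwm : AEMeasurable (fun p : E × E => ‖w p.1 - w p.2‖ₑ) (ν.prod ν) :=
    (hw.comp_fst.sub hw.comp_snd).enorm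
  rw [lintegral_eq_zero_iff' hwm] at hzero
  filter_upwards [hzero] with p hp
  simpa [sub_eq_zero] using hp

end Poincare

/-! ### Simplicity -/

/-- An exhaustion of the chamber by compact convex sets. -/
def chamberExhaustion (n R : ℕ) : Set (EuclideanSpace ℝ (Fin n)) :=
  Metric.closedBall 0 R ∩ {x | ∀ i j : Fin n, i < j → 1 / ((R : ℝ) + 1) ≤ x j - x i}

section Simplicity

variable {n : ℕ}

lemma isClosed_chamberExhaustion (n R : ℕ) : IsClosed (chamberExhaustion n R) := by
  refine Metric.isClosed_closedBall.inter ?_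
  simp only [ofPred_forall]
  exact isClosed_iInter fun i => isClosed_iInter fun j => isClosed_iInter fun _ =>
    isClosed_le (by fun_prop) (by fun_prop)

lemma isCompact_chamberExhaustion (n R : ℕ) : IsCompact (chamberExhaustion n R) :=
  Metric.isCompact_of_isClosed_isBounded (isClosed_chamberExhaustion n R)
    (Metric.isBounded_closedBall.subset Set.inter_subset_left)

lemma convex_chamberExhaustion (n R : ℕ) : Convex ℝ (chamberExhaustion n R) := by
  refine (convex_closedBall _ _).inter fun x hx y hy a b ha hb hab i j hij => ?_
  have h1 := mul_le_mul_of_nonneg_left (hx i j hij) ha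
  have h2 := mul_le_mul_of_nonneg_left (hy i j hij) hb
  have h3 : 1 / ((R : ℝ) + 1) = a * (1 / ((R : ℝ) + 1)) + b * (1 / ((R : ℝ) + 1)) := by
    rw [← add_mul, hab, one_mul]
  simp only [PiLp.add_apply, PiLp.smul_apply, smul_eq_mul]
  linarith

lemma chamberExhaustion_subset (n R : ℕ) : chamberExhaustion n R ⊆ chamber n := by
  intro x hx i j hij
  have h1 := hx.2 i j hij
  have h2 : 0 < 1 / ((R : ℝ) + 1) := by positivity
  linarith

lemma monotone_chamberExhaustion (n : ℕ) : Monotone (chamberExhaustion n) := by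
  intro R S hRS x hx
  have h : (R : ℝ) ≤ S := by exact_mod_cast hRS
  refine ⟨Metric.closedBall_subset_closedBall h hx.1, fun i j hij => le_trans ?_ (hx.2 i j hij)⟩
  gcongr

lemma iUnion_chamberExhaustion (n : ℕ) : ⋃ R, chamberExhaustion n R = chamber n := by
  refine Set.Subset.antisymm (iUnion_subset fun R => chamberExhaustion_subset n R) fun x hx => ?_
  have h1 : ∀ᶠ R : ℕ in atTop, ‖x‖ ≤ R := by
    obtain ⟨N, hN⟩ := exists_nat_ge ‖x‖
    filter_upwards [eventually_ge_atTop N] with R hR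
    exact hN.trans (by exact_mod_cast hR)
  have h2 : ∀ᶠ R : ℕ in atTop, ∀ i j : Fin n, i < j → 1 / ((R : ℝ) + 1) ≤ x j - x i := by
    rw [eventually_all]; intro i
    rw [eventually_all]; intro j
    by_cases hij : i < j
    · filter_upwards [(tendsto_one_div_add_atTop_nhds_zero_nat (𝕜 := ℝ)).eventually_lt_const
        (sub_pos.2 (hx i j hij))] with R hR _ using hR.le
    · exact Eventually.of_forall fun R h => absurd h hij
  obtain ⟨R, hR1, hR2⟩ := (h1.and h2).exists
  exact mem_iUnion.2 ⟨R, by simpa using hR1, hR2⟩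

/-- On a compact subset of the chamber the inverse of the Slater determinant is bounded, so the
weight can be removed; finite volume then passes from `L²` to `L¹`. -/
lemma tendsto_setLIntegral_enorm_of_mul {K : Set (EuclideanSpace ℝ (Fin n))} (hKc : IsCompact K)
    (hK : K ⊆ chamber n) {F : Type*} [NormedAddCommGroup F] [NormedSpace ℝ F]
    {f : ℕ → EuclideanSpace ℝ (Fin n) → F}
    (hf : ∀ k, AEStronglyMeasurable (fun x => slaterE n x • f k x) (chamberMeasure n))
    (h : Tendsto (fun k => eLpNorm (fun x => slaterE n x • f k x) 2 (chamberMeasure n)) atTop (𝓝 0)) :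
    Tendsto (fun k => ∫⁻ x in K, ‖f k x‖ₑ) atTop (𝓝 0) := by
  obtain ⟨M, hM⟩ := hKc.exists_bound_of_continuousOn (f := fun x => (slaterE n x)⁻¹)
    ((contDiff_slaterE n).continuous.continuousOn.inv₀ fun x hx => slaterE_ne_zero (hK hx))
  have hfin : volume K < ⊤ := hKc.measure_lt_top
  have hle (k : ℕ) : ∫⁻ x in K, ‖f k x‖ₑ ≤ ENNReal.ofReal M *
      (eLpNorm (fun x => slaterE n x • f k x) 2 (chamberMeasure n) * volume K ^ (2⁻¹ : ℝ)) := by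
    have hres : volume.restrict K ≤ chamberMeasure n := Measure.restrict_mono hK le_rfl
    calc ∫⁻ x in K, ‖f k x‖ₑ
        ≤ ∫⁻ x in K, ENNReal.ofReal M * ‖slaterE n x • f k x‖ₑ := by
          refine setLIntegral_mono' hKc.measurableSet fun x hx => ?_
          have e : f k x = (slaterE n x)⁻¹ • slaterE n x • f k x := by
            rw [smul_smul, inv_mul_cancel₀ (slaterE_ne_zero (hK hx)), one_smul]
          conv_lhs => rw [e]
          rw [enorm_smul]
          gcongr
          rw [← ofReal_norm]
          exact ENNReal.ofReal_le_ofReal (hM x hx)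
      _ = ENNReal.ofReal M * eLpNorm (fun x => slaterE n x • f k x) 1 (volume.restrict K) := by
          rw [lintegral_const_mul' _ _ (by finiteness), eLpNorm_one_eq_lintegral_enorm]
      _ ≤ ENNReal.ofReal M * (eLpNorm (fun x => slaterE n x • f k x) 2 (volume.restrict K) *
            (volume.restrict K) univ ^ (1 / (1 : ENNReal).toReal - 1 / (2 : ENNReal).toReal)) := by
          gcongr
          exact eLpNorm_le_eLpNorm_mul_rpow_measure_univ (by norm_num) ((hf k).mono_measure hres)
      _ ≤ _ := by
          have e : 1 / (1 : ENNReal).toReal - 1 / (2 : ENNReal).toReal = 2⁻¹ := by norm_num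
          rw [Measure.restrict_apply_univ, e]
          gcongr
  refine tendsto_of_tendsto_of_tendsto_of_le_of_le tendsto_const_nhds ?_ (fun _ => zero_le) hle
  have := ENNReal.Tendsto.const_mul (a := ENNReal.ofReal M) (ENNReal.Tendsto.mul_const
    (b := volume K ^ (2⁻¹ : ℝ)) h (Or.inr (by finiteness))) (Or.inr (by finiteness))
  simpa using this

instance (n : ℕ) : SFinite (chamberMeasure n) := by
  unfold chamberMeasure; infer_instance

lemma chamberMeasure_ne_zero (n : ℕ) : chamberMeasure n ≠ 0 := by
  intro h
  have h1 : volume (chamber n) = 0 := by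
    rw [← Measure.restrict_apply_univ]
    change chamberMeasure n univ = 0
    rw [h]; simp
  have hne : (chamber n).Nonempty :=
    ⟨WithLp.toLp 2 fun i : Fin n => (i : ℝ), fun i j hij => by simpa using hij⟩
  exact ((isOpen_chamber n).measure_pos volume hne).ne' h1

lemma IsDirichletEigenfunction.ae_eq_const_mul {v : EuclideanSpace ℝ (Fin n) → ℝ}
    (hv : IsDirichletEigenfunction n (slaterEigenvalue n) v) :
    ∃ C : ℝ, v =ᵐ[chamberMeasure n] fun x => C * slaterE n x := by
  obtain ⟨hL, φ, hφ, t1, t2⟩ := hv.exists_approx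
  rw [sub_self, zero_mul] at t2
  set w : EuclideanSpace ℝ (Fin n) → ℝ := fun x => v x / slaterE n x with hw
  have hwm : AEStronglyMeasurable w (chamberMeasure n) :=
    (hL.aestronglyMeasurable.aemeasurable.div
      (contDiff_slaterE n).continuous.measurable.aemeasurable).aestronglyMeasurable
  have hae : ∀ᵐ x ∂(chamberMeasure n), x ∈ chamber n := ae_restrict_mem (measurableSet_chamber n)
  have hmul (k : ℕ) : (fun x => slaterE n x • (φ k x / slaterE n x - w x))
      =ᵐ[chamberMeasure n] fun x => φ k x - v x := by
    filter_upwards [hae] with x hx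
    have := slaterE_ne_zero hx
    rw [hw, smul_eq_mul]
    field_simp
  have h2 (k : ℕ) := (hφ k).div_slaterE.memLp_slaterE_smul_gradient
  have t2' : Tendsto (fun k => eLpNorm (fun x => slaterE n x •
      gradient (fun y => φ k y / slaterE n y) x) 2 (chamberMeasure n)) atTop (𝓝 0) := by
    have e (k : ℕ) := (h2 k).eLpNorm_eq_integral_rpow_norm (by simp) (by simp)
    simp only [e]
    have h3 := (ENNReal.continuous_ofReal.tendsto _).comp
      (t2.rpow_const (p := (2 : ℝ)⁻¹) (Or.inr (by norm_num)))
    simpa [Function.comp_def] using h3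
  have hloc (R : ℕ) : ∀ᵐ p ∂(((volume.restrict (chamberExhaustion n R)).prod
      (volume.restrict (chamberExhaustion n R)))), w p.1 = w p.2 := by
    have hK := isCompact_chamberExhaustion n R
    have hsub := chamberExhaustion_subset n R
    refine ae_eq_of_tendsto_of_tendsto_fderiv volume hK.measurableSet
      (convex_chamberExhaustion n R) hK.isBounded
      (fun k => (hφ k).div_slaterE.smooth.of_le (by simp))
      (hwm.mono_measure (Measure.restrict_mono hsub le_rfl)) ?_ ?_
    · refine tendsto_setLIntegral_enorm_of_mul hK hsub (fun k => ?_) ?_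
      · exact ((hφ k).memLp.sub hL).aestronglyMeasurable.congr (hmul k).symm
      · simpa only [eLpNorm_congr_ae (hmul _)] using t1
    · have := tendsto_setLIntegral_enorm_of_mul hK hsub
        (fun k => (h2 k).aestronglyMeasurable) t2'
      refine this.congr fun k => lintegral_congr fun x => ?_
      rw [← ofReal_norm, norm_gradient, ofReal_norm]
  -- The exhaustion is increasing, so the squares of its members cover the square of the chamber;
  -- thus the constants on different members agree.
  have hall : ∀ᵐ p ∂((chamberMeasure n).prod (chamberMeasure n)), w p.1 = w p.2 := by
    have hU : chamber n ×ˢ chamber n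
        = ⋃ R, chamberExhaustion n R ×ˢ chamberExhaustion n R := by
      rw [← iUnion_chamberExhaustion,
        Set.iUnion_prod_of_monotone (monotone_chamberExhaustion n) (monotone_chamberExhaustion n)]
    rw [chamberMeasure, Measure.prod_restrict, hU, ae_restrict_iUnion_iff]
    intro R
    rw [← Measure.prod_restrict]
    exact hloc R
  have : (ae (chamberMeasure n)).NeBot := ae_neBot.2 (chamberMeasure_ne_zero n)
  -- By Fubini the first point can be frozen at some `x`; the constant is then `w x`.
  obtain ⟨x, hx⟩ := (Measure.ae_ae_of_ae_prod hall).exists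
  refine ⟨w x, ?_⟩
  filter_upwards [hx, hae] with y hy hyc
  change w x = w y at hy
  rw [hy, hw]
  field_simp [slaterE_ne_zero hyc]

theorem isFirstDirichletEigenfunction_slaterE (n : ℕ) :
    IsFirstDirichletEigenfunction n (slaterE n) := by
  refine ⟨slaterEigenvalue n, ⟨fun h => ?_, gradient (slaterE n), inFormDomain_slaterE n,
    fun φ hφ => weak_equation_slaterE hφ⟩, fun μ v hv => hv.slaterEigenvalue_le, fun φ hφ => ?_,
    fun v hv => hv.ae_eq_const_mul⟩
  · have : (ae (chamberMeasure n)).NeBot := ae_neBot.2 (chamberMeasure_ne_zero n)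
    obtain ⟨x, hx, hxc⟩ := (h.and (ae_restrict_mem (measurableSet_chamber n))).exists
    exact slaterE_ne_zero hxc hx
  · rw [ground_state_representation hφ]
    exact le_add_of_nonneg_right (integral_nonneg fun x => by positivity)

end Simplicity

end SlaterHO

/-- Here `n = m + 1 ≥ 1`. -/
theorem proposition5p1 (m : ℕ) :
    -- the product formula for the Slater determinant
    (∃ B : ℝ, B ≠ 0 ∧ ∀ x : EuclideanSpace ℝ (Fin (m + 1)),
      SlaterHO.slater (m + 1) (fun i => x i)
        = B * Real.exp (-‖x‖ ^ 2 / 2) * SlaterHO.vdm (m + 1) (fun i => x i)) ∧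
    -- it is the first Dirichlet eigenfunction of the `n`-particle operator
    SlaterHO.IsFirstDirichletEigenfunction (m + 1)
      (fun x => SlaterHO.slater (m + 1) (fun i => x i)) ∧
    -- linear independence at `n - 1` distinct points
    (∀ c : Fin m → ℝ, Function.Injective c →
      LinearIndependent ℝ (fun j : Fin m => SlaterHO.hVec (m + 1) (c j))) ∧
    -- zeros of linear combinations
    (∀ b : Fin (m + 1) → ℝ, b ≠ 0 →
      {x : ℝ | SlaterHO.linComb b x = 0}.encard ≤ m ∧
      ∀ c : Fin m → ℝ, Function.Injective c →
        {x : ℝ | SlaterHO.linComb b x = 0} = Set.range c →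
        ∃ C : ℝ, C ≠ 0 ∧ ∀ x : ℝ,
          SlaterHO.linComb b x
            = C * SlaterHO.slater (m + 1) (Fin.snoc (α := fun _ => ℝ) c x)) ∧
    -- zeros of the Slater determinant in its last variable
    (∀ c : Fin m → ℝ, Function.Injective c →
      (∀ j : Fin m, analyticOrderAt
        (fun x : ℝ => SlaterHO.slater (m + 1) (Fin.snoc (α := fun _ => ℝ) c x)) (c j) = 1) ∧
      {x : ℝ | SlaterHO.slater (m + 1) (Fin.snoc (α := fun _ => ℝ) c x) = 0} = Set.range c) := by
  refine ⟨SlaterHO.exists_slaterE_eq (m + 1),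
    SlaterHO.isFirstDirichletEigenfunction_slaterE (m + 1),
    fun c hc => SlaterHO.linearIndependent_hVec hc,
    fun b hb => ⟨SlaterHO.encard_zeros_linComb_le hb,
      fun c hc hz => SlaterHO.linComb_eq_slater hb hc hz⟩,
    fun c hc => ⟨fun j => SlaterHO.analyticOrderAt_slater_snoc hc j,
      SlaterHO.zeros_slater_snoc hc⟩⟩
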